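/- Fix an integer $K\ge 1$, channel parameters $0\le p_{01}\le p_{11}\le 1$ and a Lagrange multiplier $\lambda\ge 0$. For $k\in\{1,\dots,K\}$ put $(k)_+=(k \bmod K)+1$, $(k)_-=((K+k-2)\bmod K)+1$, $\mathcal A_k=\{mK+(k)_-: m=0,1,2,\dots\}$; put $\mathcal T(\omega)=\omega p_{11}+(1-\omega)p_{01}$ and $\Omega_\Delta=\{\mathcal T^m(p_{01}),\mathcal T^m(p_{11}) : 0\le m<\Delta\}$. Consider the Markov decision process (the belief MDP without channel sensing) with state space $\mathcal S=\{(\Delta,k,\omega): 1\le k\le K,\ \Delta\in\mathcal A_k,\ \omega\in\Omega_\Delta\}$ (age of information, relative slot index in the frame, belief that the channel is good) and actions $u\in\{0,1\}$ (suspend, transmit). From $(\Delta,k,\omega)$, action $u=0$ leads to $(\Delta+1,(k)_+,\mathcal T(\omega))$ with probability $1$; action $u=1$ leads to $(k,(k)_+,p_{11})$ with probability $\omega$ and to $(\Delta+1,(k)_+,p_{01})$ with probability $1-\omega$. The one-slot cost is $C(\mathbf s,u;\lambda)=\Delta+\lambda u$. For a (possibly history-dependent and randomized) policy $\pi$ and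 an initial state $\mathbf s$, let $\bar L_{\mathbf s}(\pi;\lambda)=\limsup_{T\to\infty}\frac1T\,\mathbb E_\pi\big[\sum_{t=1}^T C(\mathbf s_t,u_t;\lambda)\,\big|\,\mathbf s_1=\mathbf s\big]\in[0,\infty]$. Then there are thresholds $\omega^\star(\Delta,k;\lambda)\in\mathbb R$ such that the stationary deterministic policy $\pi^\star_\lambda=(d^\star_\lambda,d^\star_\lambda,\dots)$ with $$d^\star_\lambda(\Delta,k,\omega)=\begin{cases}0 & \text{if } \omega<\omega^\star(\Delta,k;\lambda),\\ 1 & \text{if } \omega\ge\omega^\star(\Delta,k;\lambda),\end{cases}\qquad (\Delta,k,\omega)\in\mathcal S,$$ is average cost optimal: $\bar L_{\mathbf s}(\pi^\star_\lambda;\lambda)\le \bar L_{\mathbf s}(\pi;\lambda)$ for every initial state $\mathbf s\in\mathcal S$ and every policy $\pi$. Moreover $\pi^\star_\lambda$ can be chosen to respect the rule that an update which has already been delivered is not transmitted again: $d^\star_\lambda(\Delta,k,\omega)=0$ whenever $\Delta<K$. -/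

import Mathlib

open scoped NNReal ENNReal

noncomputable section

/-- Parameters of the status update system: frame length `K` and the transition probabilities
`p11 = P(good → good)`, `p01 = P(bad → good)` of a positively correlated two-state channel. -/
structure AoIModel where
  K : ℕ
  p11 : ℝ
  p01 : ℝ
  one_le_K : 1 ≤ K
  p01_nonneg : 0 ≤ p01
  p01_le_p11 : p01 ≤ p11
  p11_le_one : p11 ≤ 1

namespace AoIModel

variable (M : AoIModel)

/-- Relative slot index following `k`. -/
def nextSlot (k : ℕ) : ℕ := k % M.K + 1

/-- Relative slot index preceding `k` (for `1 ≤ k ≤ K`). -/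
def prevSlot (k : ℕ) : ℕ := (M.K + k - 2) % M.K + 1

/-- One-step belief update without observation. -/
def beliefStep (ω : ℝ) : ℝ := ω * M.p11 + (1 - ω) * M.p01

/-- Possible AoI values at relative slot `k`. -/
def ages (k : ℕ) : Set ℕ := {Δ | ∃ m : ℕ, Δ = m * M.K + M.prevSlot k}

/-- Possible beliefs when the AoI is `Δ`. -/
def beliefs (Δ : ℕ) : Set ℝ :=
  {ω | ∃ m : ℕ, m < Δ ∧ (ω = M.beliefStep^[m] M.p01 ∨ ω = M.beliefStep^[m] M.p11)}

/-- States of the belief MDP: triples (AoI, relative slot index, belief). -/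
@[ext]
structure State where
  age : ℕ
  slot : ℕ
  belief : ℝ
  slot_mem : slot ∈ Set.Icc 1 M.K
  age_mem : age ∈ M.ages slot
  belief_mem : belief ∈ M.beliefs age

theorem nextSlot_mem (k : ℕ) : M.nextSlot k ∈ Set.Icc 1 M.K := by
  have h := Nat.mod_lt k (show 0 < M.K from M.one_le_K)
  simp only [nextSlot, Set.mem_Icc]
  omega

theorem prevSlot_nextSlot {k : ℕ} (hk : k ∈ Set.Icc 1 M.K) :
    M.prevSlot (M.nextSlot k) = k := by
  obtain ⟨h1, h2⟩ := hk
  unfold prevSlot nextSlot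
  rcases h2.lt_or_eq with h | h
  · rw [Nat.mod_eq_of_lt h, show M.K + (k + 1) - 2 = (k - 1) + M.K by omega,
      Nat.add_mod_right, Nat.mod_eq_of_lt (by omega)]
    omega
  · subst h
    rw [Nat.mod_self, Nat.mod_eq_of_lt (by omega)]
    omega

theorem ack_age_mem {k : ℕ} (hk : k ∈ Set.Icc 1 M.K) : k ∈ M.ages (M.nextSlot k) :=
  ⟨0, by rw [M.prevSlot_nextSlot hk]; omega⟩

theorem succ_age_mem {k Δ : ℕ} (hk : k ∈ Set.Icc 1 M.K) (hΔ : Δ ∈ M.ages k) :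
    Δ + 1 ∈ M.ages (M.nextSlot k) := by
  obtain ⟨m, rfl⟩ := hΔ
  unfold ages
  simp only [Set.mem_ofPred_eq, M.prevSlot_nextSlot hk]
  obtain ⟨h1, h2⟩ := hk
  unfold prevSlot
  rcases h1.lt_or_eq with h | h
  · refine ⟨m, ?_⟩
    rw [show M.K + k - 2 = (k - 2) + M.K by omega, Nat.add_mod_right,
      Nat.mod_eq_of_lt (by omega)]
    omega
  · subst h
    refine ⟨m + 1, ?_⟩
    rw [Nat.mod_eq_of_lt (by omega), Nat.add_mul]
    omega

theorem beliefStep_mem {ω : ℝ} (h : ω ∈ Set.Icc (0 : ℝ) 1) :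
    M.beliefStep ω ∈ Set.Icc (0 : ℝ) 1 := by
  obtain ⟨h0, h1⟩ := h
  have a := M.p01_nonneg
  have b := M.p01_le_p11
  have c := M.p11_le_one
  constructor <;> unfold beliefStep <;> nlinarith

theorem belief_mem_Icc {Δ : ℕ} {ω : ℝ} (h : ω ∈ M.beliefs Δ) : ω ∈ Set.Icc (0 : ℝ) 1 := by
  have key : ∀ (m : ℕ) (x : ℝ), x ∈ Set.Icc (0 : ℝ) 1 →
      M.beliefStep^[m] x ∈ Set.Icc (0 : ℝ) 1 := by
    intro m
    induction m with
    | zero => intro x hx; exact hx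
    | succ m ih => intro x hx; exact ih _ (M.beliefStep_mem hx)
  have a := M.p01_nonneg
  have b := M.p01_le_p11
  have c := M.p11_le_one
  obtain ⟨m, -, rfl | rfl⟩ := h
  · exact key m _ ⟨a, b.trans c⟩
  · exact key m _ ⟨a.trans b, c⟩

variable {M}

/-- Next state after a suspension. -/
def State.suspended (s : M.State) : M.State where
  age := s.age + 1
  slot := M.nextSlot s.slot
  belief := M.beliefStep s.belief
  slot_mem := M.nextSlot_mem s.slot
  age_mem := M.succ_age_mem s.slot_mem s.age_mem
  belief_mem := by
    obtain ⟨m, hm, h | h⟩ := s.belief_mem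
    · exact ⟨m + 1, by omega, Or.inl (by rw [h, Function.iterate_succ_apply'])⟩
    · exact ⟨m + 1, by omega, Or.inr (by rw [h, Function.iterate_succ_apply'])⟩

/-- Next state after a successful transmission. -/
def State.ack (s : M.State) : M.State where
  age := s.slot
  slot := M.nextSlot s.slot
  belief := M.p11
  slot_mem := M.nextSlot_mem s.slot
  age_mem := M.ack_age_mem s.slot_mem
  belief_mem := ⟨0, s.slot_mem.1, Or.inr rfl⟩

/-- Next state after a failed transmission. -/
def State.nack (s : M.State) : M.State where
  age := s.age + 1
  slot := M.nextSlot s.slot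
  belief := M.p01
  slot_mem := M.nextSlot_mem s.slot
  age_mem := M.succ_age_mem s.slot_mem s.age_mem
  belief_mem := ⟨0, Nat.succ_pos _, Or.inl rfl⟩

/-- Next state given the action `u` (`true` = transmit) and the observation `θ` (`true` = ACK). -/
def State.next (s : M.State) (u θ : Bool) : M.State :=
  if u then (if θ then s.ack else s.nack) else s.suspended

theorem State.toNNReal_belief_le_one (s : M.State) : s.belief.toNNReal ≤ 1 :=
  Real.toNNReal_le_one.2 (M.belief_mem_Icc s.belief_mem).2

/-- Law of the observation given state and action: a transmission is acknowledged with
probability equal to the belief; without transmission there is never an ACK. -/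
def obsLaw (s : M.State) (u : Bool) : PMF Bool :=
  if u then PMF.bernoulli s.belief.toNNReal s.toNNReal_belief_le_one else PMF.pure false

/-- Transition law of the belief MDP. -/
def transition (s : M.State) (u : Bool) : PMF M.State :=
  (obsLaw s u).map (s.next u)

/-- One-slot Lagrangian cost: AoI plus `lam` times the energy consumed. -/
def cost (lam : ℝ≥0) (s : M.State) (u : Bool) : ℝ≥0 :=
  (s.age : ℝ≥0) + lam * (if u then 1 else 0)

variable (M)

/-- Past states and actions, most recent first. -/
abbrev History := List (M.State × Bool)

/-- History-dependent, possibly randomized scheduling policies: the past (whose length tells the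
time slot) and the current state determine a distribution over actions. -/
abbrev Policy := M.History → M.State → PMF Bool

variable {M}

/-- The stationary deterministic policy with decision rule `d`. -/
def stationary (d : M.State → Bool) : M.Policy := fun _ s => PMF.pure (d s)

/-- Joint law of `(s_1, u_1), …, (s_t, u_t)` (as a history) and `s_{t+1}` under the policy `π`
started at `s_1 = s₁`. -/
def pathLaw (π : M.Policy) (s₁ : M.State) : ℕ → PMF (M.History × M.State)
  | 0 => PMF.pure ([], s₁)
  | t + 1 => (pathLaw π s₁ t).bind fun x =>
      (π x.1 x.2).bind fun u =>
        (transition x.2 u).map fun s' => ((x.2, u) :: x.1, s')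

/-- Total Lagrangian cost along a history. -/
def totalCost (lam : ℝ≥0) (h : M.History) : ℝ≥0 :=
  (h.map fun y => cost lam y.1 y.2).sum

/-- Expected total Lagrangian cost over the slots `1, …, T`. -/
def expectedCost (lam : ℝ≥0) (π : M.Policy) (s₁ : M.State) (T : ℕ) : ℝ≥0∞ :=
  ∑' x : M.History × M.State, pathLaw π s₁ T x * (totalCost lam x.1 : ℝ≥0∞)

/-- Long-run average Lagrangian cost (upper limit). -/
def averageCost (lam : ℝ≥0) (π : M.Policy) (s₁ : M.State) : ℝ≥0∞ :=
  Filter.limsup (fun T : ℕ => expectedCost lam π s₁ T / (T : ℝ≥0∞)) Filter.atTop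

/-- The decision rule `d` is of threshold type in the belief. -/
def IsBeliefThreshold (d : M.State → Bool) : Prop :=
  ∃ thr : ℕ → ℕ → ℝ, ∀ s : M.State, d s = true ↔ thr s.age s.slot ≤ s.belief

end AoIModel

end

/-! The proof is a vanishing discount argument. Value functions are extended from the state space to
all (Δ, k, ω) with ω in [0, 1], so that concavity in the belief makes sense. The invariant `Regular`
survives the Bellman operator (`Regular.bellman`) and pointwise limits (`Regular.of_tendsto`).

It yields thresholds as follows. Let A(ω) be the advantage of transmitting. Suspending is concave in
ω and transmitting is affine, so A is concave. The field `gap`, which bounds the defect of concavity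
by the price of one transmission weighted with the probability of failure, gives A(ω) ≤ ω A(1). So
A(y) ≥ 0 forces A(1) ≥ 0, and by concavity A ≥ 0 on [y, 1] (`Regular.advantage_nonneg`).

If p01 > 0, transmitting in every slot reaches the reference state (K, 1, p11) at a cost bounded
uniformly in the discount factor α, and up to a power of α no state is cheaper than the reference.
Differences of discounted values are therefore bounded at each state, and a limit as α ↑ 1 solves
the average cost optimality equation (`exists_relativeValue`). Telescoping that equation bounds the
cost of the threshold policy by the gain g (`averageCost_stationary_le`); an Abelian argument shows
that no policy does better (`le_averageCost`).

If p01 = 0 and p11 < 1, the channel dies and every policy has infinite cost. If p01 = 0 and p11 = 1,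
the channel is frozen: belief 0 costs infinitely much, and belief 1 behaves like an always good
channel, to which the case p01 > 0 applies. -/

noncomputable section

namespace AoIModel

open Filter Topology Set

/-! ### Structural properties preserved by the Bellman operator -/

section

/-- Structural properties of relative value functions of (age, slot, belief): monotone in the age,
antitone and concave in the belief, with a one-sided bound on the defect of concavity. -/
structure Regular (lam : ℝ) (W : ℕ → ℕ → ℝ → ℝ) : Prop where
  age_mono : ∀ k, ∀ ω ∈ Icc (0 : ℝ) 1, Monotone fun Δ => W Δ k ω
  belief_anti : ∀ Δ k, AntitoneOn (W Δ k) (Icc 0 1)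
  concave : ∀ Δ k, ConcaveOn ℝ (Icc 0 1) (W Δ k)
  gap : ∀ Δ k, ∀ x ∈ Icc (0 : ℝ) 1, ∀ y ∈ Icc (0 : ℝ) 1, ∀ t ∈ Icc (0 : ℝ) 1, y ≤ x →
    W Δ k (t * x + (1 - t) * y) ≤ t * W Δ k x + (1 - t) * (W Δ k y + lam)

variable (M : AoIModel)

/-- Expected continuation value of a transmission. -/
def transmitValue (W : ℕ → ℕ → ℝ → ℝ) (Δ k : ℕ) (ω : ℝ) : ℝ :=
  ω * W (min k (Δ + 1)) (M.nextSlot k) M.p11 + (1 - ω) * W (Δ + 1) (M.nextSlot k) M.p01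

/-- Continuation value of a suspension. -/
def suspendValue (W : ℕ → ℕ → ℝ → ℝ) (Δ k : ℕ) (ω : ℝ) : ℝ :=
  W (Δ + 1) (M.nextSlot k) (M.beliefStep ω)

/-- Dynamic programming operator with discount factor `α`. -/
def bellman (α lam : ℝ) (W : ℕ → ℕ → ℝ → ℝ) (Δ k : ℕ) (ω : ℝ) : ℝ :=
  Δ + min (α * M.suspendValue W Δ k ω) (lam + α * M.transmitValue W Δ k ω)

/-- Advantage of transmitting over suspending. -/
def advantage (α lam : ℝ) (W : ℕ → ℕ → ℝ → ℝ) (Δ k : ℕ) (ω : ℝ) : ℝ :=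
  α * M.suspendValue W Δ k ω - (lam + α * M.transmitValue W Δ k ω)

theorem p01_mem : M.p01 ∈ Icc (0 : ℝ) 1 :=
  ⟨M.p01_nonneg, M.p01_le_p11.trans M.p11_le_one⟩

theorem p11_mem : M.p11 ∈ Icc (0 : ℝ) 1 :=
  ⟨M.p01_nonneg.trans M.p01_le_p11, M.p11_le_one⟩

theorem beliefStep_mono {x y : ℝ} (h : x ≤ y) : M.beliefStep x ≤ M.beliefStep y := by
  have := mul_le_mul_of_nonneg_right h (sub_nonneg.2 M.p01_le_p11)
  unfold beliefStep
  linarith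

theorem beliefStep_combo (t x y : ℝ) :
    M.beliefStep (t * x + (1 - t) * y) = t * M.beliefStep x + (1 - t) * M.beliefStep y := by
  unfold beliefStep
  ring

theorem beliefStep_le {ω : ℝ} (h : ω ≤ 1) : M.beliefStep ω ≤ M.p11 := by
  simpa [beliefStep] using M.beliefStep_mono h

theorem le_beliefStep {ω : ℝ} (h : 0 ≤ ω) : M.p01 ≤ M.beliefStep ω := by
  simpa [beliefStep] using M.beliefStep_mono h

theorem combo_mem {x y t : ℝ} (hx : x ∈ Icc (0 : ℝ) 1) (hy : y ∈ Icc (0 : ℝ) 1)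
    (ht : t ∈ Icc (0 : ℝ) 1) : t * x + (1 - t) * y ∈ Icc (0 : ℝ) 1 := by
  have := convex_Icc (0 : ℝ) 1 hx hy ht.1 (sub_nonneg.2 ht.2) (by ring)
  simpa using this

theorem concaveOn_Icc_of_combo {f : ℝ → ℝ}
    (h : ∀ x ∈ Icc (0 : ℝ) 1, ∀ y ∈ Icc (0 : ℝ) 1, ∀ t ∈ Icc (0 : ℝ) 1,
      t * f x + (1 - t) * f y ≤ f (t * x + (1 - t) * y)) :
    ConcaveOn ℝ (Icc 0 1) f := by
  refine ⟨convex_Icc 0 1, fun x hx y hy a b ha hb hab => ?_⟩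
  obtain rfl : b = 1 - a := by linarith
  simpa using h x hx y hy a ⟨ha, by linarith⟩

theorem transmitValue_combo (W : ℕ → ℕ → ℝ → ℝ) (Δ k : ℕ) (t x y : ℝ) :
    M.transmitValue W Δ k (t * x + (1 - t) * y) =
      t * M.transmitValue W Δ k x + (1 - t) * M.transmitValue W Δ k y := by
  unfold transmitValue
  ring

namespace Regular

variable {M} {lam α : ℝ} {W : ℕ → ℕ → ℝ → ℝ}

theorem combo_le (hW : Regular lam W) (Δ k : ℕ) {x y t : ℝ} (hx : x ∈ Icc (0 : ℝ) 1)
    (hy : y ∈ Icc (0 : ℝ) 1) (ht : t ∈ Icc (0 : ℝ) 1) :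
    t * W Δ k x + (1 - t) * W Δ k y ≤ W Δ k (t * x + (1 - t) * y) := by
  have := (hW.concave Δ k).2 hx hy ht.1 (sub_nonneg.2 ht.2) (by ring)
  simpa using this

theorem suspendValue_combo_le (hW : Regular lam W) (Δ k : ℕ) {x y t : ℝ}
    (hx : x ∈ Icc (0 : ℝ) 1) (hy : y ∈ Icc (0 : ℝ) 1) (ht : t ∈ Icc (0 : ℝ) 1) :
    t * M.suspendValue W Δ k x + (1 - t) * M.suspendValue W Δ k y ≤
      M.suspendValue W Δ k (t * x + (1 - t) * y) := by
  unfold suspendValue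
  rw [beliefStep_combo]
  exact hW.combo_le _ _ (M.beliefStep_mem hx) (M.beliefStep_mem hy) ht

/-- Apart from its price, a transmission only helps: it reveals the channel, which concavity
rewards, and an ACK does not raise the age. The latter needs the `min` in `transmitValue`, which
matters only off the state space (see `State.slot_le`). -/
theorem transmitValue_le (hW : Regular lam W) (Δ k : ℕ) {ω : ℝ} (hω : ω ∈ Icc (0 : ℝ) 1) :
    M.transmitValue W Δ k ω ≤ M.suspendValue W Δ k ω := by
  have h1 : W (min k (Δ + 1)) (M.nextSlot k) M.p11 ≤ W (Δ + 1) (M.nextSlot k) M.p11 :=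
    hW.age_mono _ _ M.p11_mem (min_le_right _ _)
  have h2 := hW.combo_le (Δ + 1) (M.nextSlot k) M.p11_mem M.p01_mem hω
  have h3 := mul_le_mul_of_nonneg_left h1 hω.1
  unfold transmitValue suspendValue beliefStep
  linarith

/-- This is `gap` applied to the beliefs p11 and p01 with weight ω, whose mixture is the belief
after a suspension. -/
theorem advantage_le (hW : Regular lam W) (hlam : 0 ≤ lam) (hα1 : α ≤ 1)
    (hα0 : 0 ≤ α) (Δ k : ℕ) {ω : ℝ} (hω : ω ∈ Icc (0 : ℝ) 1) :
    M.advantage α lam W Δ k ω ≤ ω * M.advantage α lam W Δ k 1 := by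
  have h := hW.gap (Δ + 1) (M.nextSlot k) _ M.p11_mem _ M.p01_mem ω hω M.p01_le_p11
  have h' := mul_le_mul_of_nonneg_left h hα0
  have h2 : α * ((1 - ω) * lam) ≤ (1 - ω) * lam :=
    mul_le_of_le_one_left (mul_nonneg (sub_nonneg.2 hω.2) hlam) hα1
  simp only [advantage, suspendValue, transmitValue, beliefStep, one_mul, sub_self, zero_mul,
    add_zero]
  linarith

theorem advantage_nonneg (hW : Regular lam W) (hlam : 0 ≤ lam) (hα1 : α ≤ 1)
    (hα0 : 0 ≤ α) (Δ k : ℕ) {x y : ℝ} (hx : x ∈ Icc (0 : ℝ) 1) (hy : y ∈ Icc (0 : ℝ) 1)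
    (hyx : y ≤ x) (h : 0 ≤ M.advantage α lam W Δ k y) : 0 ≤ M.advantage α lam W Δ k x := by
  have one_mem : (1 : ℝ) ∈ Icc (0 : ℝ) 1 := ⟨zero_le_one, le_rfl⟩
  have h1 : 0 ≤ M.advantage α lam W Δ k 1 := by
    rcases hy.1.lt_or_eq with h0 | rfl
    · exact nonneg_of_mul_nonneg_right (h.trans (hW.advantage_le hlam hα1 hα0 Δ k hy)) h0
    -- At belief 0 the advantage is -lam, so `h` forces lam = 0, and then transmitting at belief 1
    -- is at least as good as suspending.
    · have h2 : M.advantage α lam W Δ k 0 = -lam := by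
        simp [advantage, suspendValue, transmitValue, beliefStep]
      have h3 := mul_le_mul_of_nonneg_left (hW.transmitValue_le (M := M) Δ k one_mem) hα0
      unfold advantage at h2 h ⊢
      linarith
  rcases hyx.lt_or_eq with hlt | rfl
  · obtain ⟨t, ht, rfl⟩ : ∃ t ∈ Icc (0 : ℝ) 1, t * y + (1 - t) * 1 = x := by
      have hp : 0 < 1 - y := by linarith [hx.2]
      refine ⟨(1 - x) / (1 - y), ⟨div_nonneg (by linarith [hx.2]) hp.le, ?_⟩, ?_⟩
      · rw [div_le_one hp]; linarith
      · field_simp; ring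
    have h2 := mul_le_mul_of_nonneg_left (hW.suspendValue_combo_le (M := M) Δ k hy one_mem ht) hα0
    have h3 := M.transmitValue_combo W Δ k t y 1
    have h4 := mul_nonneg ht.1 h
    have h5 := mul_nonneg (sub_nonneg.2 ht.2) h1
    unfold advantage at h4 h5 ⊢
    rw [h3]
    linarith
  · exact h

theorem bellman (hW : Regular lam W) (hlam : 0 ≤ lam) (hα0 : 0 ≤ α) (hα1 : α ≤ 1) :
    Regular lam (M.bellman α lam W) where
  age_mono k ω hω Δ Δ' h := by
    have h1 : M.suspendValue W Δ k ω ≤ M.suspendValue W Δ' k ω :=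
      hW.age_mono _ _ (M.beliefStep_mem hω) (Nat.succ_le_succ h)
    have h2 : M.transmitValue W Δ k ω ≤ M.transmitValue W Δ' k ω :=
      add_le_add
        (mul_le_mul_of_nonneg_left (hW.age_mono _ _ M.p11_mem
          (min_le_min le_rfl (Nat.succ_le_succ h))) hω.1)
        (mul_le_mul_of_nonneg_left (hW.age_mono _ _ M.p01_mem (Nat.succ_le_succ h))
          (sub_nonneg.2 hω.2))
    have h3 : (Δ : ℝ) ≤ Δ' := by exact_mod_cast h
    simp only [AoIModel.bellman]
    gcongr
  belief_anti Δ k x hx y hy hxy := by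
    have h1 : M.suspendValue W Δ k y ≤ M.suspendValue W Δ k x :=
      hW.belief_anti _ _ (M.beliefStep_mem hx) (M.beliefStep_mem hy) (M.beliefStep_mono hxy)
    have h2 : M.transmitValue W Δ k y ≤ M.transmitValue W Δ k x := by
      have h3 : W (min k (Δ + 1)) (M.nextSlot k) M.p11 ≤ W (Δ + 1) (M.nextSlot k) M.p01 :=
        (hW.age_mono _ _ M.p11_mem (min_le_right _ _)).trans
          (hW.belief_anti _ _ M.p01_mem M.p11_mem M.p01_le_p11)
      have := mul_le_mul_of_nonneg_left h3 (sub_nonneg.2 hxy)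
      unfold transmitValue
      linarith
    simp only [AoIModel.bellman]
    gcongr
  concave Δ k := by
    refine concaveOn_Icc_of_combo fun x hx y hy t ht => ?_
    have h1 := mul_le_mul_of_nonneg_left (hW.suspendValue_combo_le (M := M) Δ k hx hy ht) hα0
    have h2 := M.transmitValue_combo W Δ k t x y
    have ht' := sub_nonneg.2 ht.2
    simp only [AoIModel.bellman]
    rw [h2, ← sub_le_iff_le_add', le_min_iff]
    constructor
    · have h3 := mul_le_mul_of_nonneg_left (min_le_left (α * M.suspendValue W Δ k x)
        (lam + α * M.transmitValue W Δ k x)) ht.1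
      have h4 := mul_le_mul_of_nonneg_left (min_le_left (α * M.suspendValue W Δ k y)
        (lam + α * M.transmitValue W Δ k y)) ht'
      linarith
    · have h3 := mul_le_mul_of_nonneg_left (min_le_right (α * M.suspendValue W Δ k x)
        (lam + α * M.transmitValue W Δ k x)) ht.1
      have h4 := mul_le_mul_of_nonneg_left (min_le_right (α * M.suspendValue W Δ k y)
        (lam + α * M.transmitValue W Δ k y)) ht'
      linarith
  gap Δ k x hx y hy t ht hyx := by
    have ht' := sub_nonneg.2 ht.2
    have hmem := combo_mem hx hy ht
    -- If transmitting is optimal at x, compare with transmitting at the mixture, where the value is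
    -- affine; the extra (1 - t) lam pays for it at y. Otherwise suspending is optimal at x and, by
    -- the threshold property, at y, and `gap` is inherited from W.
    by_cases h : 0 ≤ M.advantage α lam W Δ k x
    · have e : M.bellman α lam W Δ k x = Δ + (lam + α * M.transmitValue W Δ k x) := by
        rw [AoIModel.bellman, min_eq_right (sub_nonneg.1 h)]
      have h1 : Δ + α * M.transmitValue W Δ k y ≤ M.bellman α lam W Δ k y :=
        add_le_add le_rfl (le_min
          (mul_le_mul_of_nonneg_left (hW.transmitValue_le Δ k hy) hα0) (by linarith))
      have h2 : M.bellman α lam W Δ k (t * x + (1 - t) * y) ≤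
          Δ + (lam + α * M.transmitValue W Δ k (t * x + (1 - t) * y)) :=
        add_le_add le_rfl (min_le_right _ _)
      rw [transmitValue_combo] at h2
      have h3 := mul_le_mul_of_nonneg_left h1 ht'
      rw [e]
      linarith
    · have hy' : ¬ 0 ≤ M.advantage α lam W Δ k y := fun h' =>
        h (hW.advantage_nonneg hlam hα1 hα0 Δ k hx hy hyx h')
      have e : ∀ z, ¬ 0 ≤ M.advantage α lam W Δ k z →
          M.bellman α lam W Δ k z = Δ + α * M.suspendValue W Δ k z := fun z hz => by
        rw [AoIModel.bellman, min_eq_left (sub_neg.1 (not_le.1 hz)).le]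
      have h2 : M.bellman α lam W Δ k (t * x + (1 - t) * y) ≤
          Δ + α * M.suspendValue W Δ k (t * x + (1 - t) * y) :=
        add_le_add le_rfl (min_le_left _ _)
      have h3 := hW.gap (Δ + 1) (M.nextSlot k) _ (M.beliefStep_mem hx) _ (M.beliefStep_mem hy)
        t ht (M.beliefStep_mono hyx)
      have h4 := mul_le_mul_of_nonneg_left h3 hα0
      rw [← M.beliefStep_combo] at h4
      have h5 : α * ((1 - t) * lam) ≤ (1 - t) * lam :=
        mul_le_of_le_one_left (mul_nonneg ht' hlam) hα1
      rw [e x h, e y hy']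
      unfold suspendValue at h2 ⊢
      linarith

theorem zero (hlam : 0 ≤ lam) : Regular lam fun _ _ _ => 0 where
  age_mono _ _ _ _ _ _ := le_rfl
  belief_anti _ _ _ _ _ _ _ := le_rfl
  concave _ _ := concaveOn_const 0 (convex_Icc 0 1)
  gap _ _ _ _ _ _ t ht _ := by
    have := mul_nonneg (sub_nonneg.2 ht.2) hlam
    simpa using this

theorem sub_const (hW : Regular lam W) (c : ℝ) : Regular lam fun Δ k ω => W Δ k ω - c where
  age_mono k ω hω _ _ h := sub_le_sub_right (hW.age_mono k ω hω h) c
  belief_anti Δ k _ hx _ hy h := sub_le_sub_right (hW.belief_anti Δ k hx hy h) c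
  concave Δ k := concaveOn_Icc_of_combo fun x hx y hy t ht => by
    have := hW.combo_le Δ k hx hy ht
    linarith
  gap Δ k x hx y hy t ht h := by
    have := hW.gap Δ k x hx y hy t ht h
    linarith

theorem of_tendsto {ι : Type*} {F : Filter ι} [F.NeBot] {V : ι → ℕ → ℕ → ℝ → ℝ}
    (hV : ∀ᶠ i in F, Regular lam (V i))
    (h : ∀ Δ k, ∀ ω ∈ Icc (0 : ℝ) 1, Tendsto (fun i => V i Δ k ω) F (𝓝 (W Δ k ω))) :
    Regular lam W where
  age_mono k ω hω Δ Δ' hΔ := le_of_tendsto_of_tendsto (h Δ k ω hω) (h Δ' k ω hω)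
    (hV.mono fun _ hi => hi.age_mono k ω hω hΔ)
  belief_anti Δ k x hx y hy hxy := le_of_tendsto_of_tendsto (h Δ k y hy) (h Δ k x hx)
    (hV.mono fun _ hi => hi.belief_anti Δ k hx hy hxy)
  concave Δ k := concaveOn_Icc_of_combo fun x hx y hy t ht =>
    le_of_tendsto_of_tendsto (((h Δ k x hx).const_mul t).add ((h Δ k y hy).const_mul (1 - t)))
      (h Δ k _ (combo_mem hx hy ht)) (hV.mono fun _ hi => hi.combo_le Δ k hx hy ht)
  gap Δ k x hx y hy t ht hyx :=
    le_of_tendsto_of_tendsto (h Δ k _ (combo_mem hx hy ht))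
      (((h Δ k x hx).const_mul t).add (((h Δ k y hy).add_const lam).const_mul (1 - t)))
      (hV.mono fun _ hi => hi.gap Δ k x hx y hy t ht hyx)

end Regular

end

/-! ### Discounted values and their limit as the discount factor tends to 1 -/

section

variable (M : AoIModel)

/-- Optimal `n`-slot discounted cost. -/
def valueIter (α lam : ℝ) : ℕ → ℕ → ℕ → ℝ → ℝ
  | 0 => fun _ _ _ => 0
  | n + 1 => M.bellman α lam (valueIter α lam n)

/-- Optimal discounted cost over an infinite horizon. -/
def discountedValue (α lam : ℝ) (Δ k : ℕ) (ω : ℝ) : ℝ :=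
  ⨆ n, M.valueIter α lam n Δ k ω

variable {M} {α lam : ℝ}

theorem bellman_mono {W W' : ℕ → ℕ → ℝ → ℝ} (hα0 : 0 ≤ α)
    (h : ∀ Δ k, ∀ ω ∈ Icc (0 : ℝ) 1, W Δ k ω ≤ W' Δ k ω) (Δ k : ℕ) {ω : ℝ}
    (hω : ω ∈ Icc (0 : ℝ) 1) : M.bellman α lam W Δ k ω ≤ M.bellman α lam W' Δ k ω := by
  have h1 : M.suspendValue W Δ k ω ≤ M.suspendValue W' Δ k ω := h _ _ _ (M.beliefStep_mem hω)
  have h2 : M.transmitValue W Δ k ω ≤ M.transmitValue W' Δ k ω :=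
    add_le_add (mul_le_mul_of_nonneg_left (h _ _ _ M.p11_mem) hω.1)
      (mul_le_mul_of_nonneg_left (h _ _ _ M.p01_mem) (sub_nonneg.2 hω.2))
  unfold bellman
  gcongr

theorem bellman_le_suspend (W : ℕ → ℕ → ℝ → ℝ) (Δ k : ℕ) (ω : ℝ) :
    M.bellman α lam W Δ k ω ≤ Δ + α * W (Δ + 1) (M.nextSlot k) (M.beliefStep ω) :=
  add_le_add le_rfl (min_le_left _ _)

theorem bellman_le_transmit (W : ℕ → ℕ → ℝ → ℝ) (Δ k : ℕ) (ω : ℝ) :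
    M.bellman α lam W Δ k ω ≤ Δ + (lam + α * M.transmitValue W Δ k ω) :=
  add_le_add le_rfl (min_le_right _ _)

theorem le_bellman {W : ℕ → ℕ → ℝ → ℝ} {Δ k : ℕ} {ω c : ℝ} (hα0 : 0 ≤ α) (hlam : 0 ≤ lam)
    (hω : ω ∈ Icc (0 : ℝ) 1) (hs : c ≤ W (Δ + 1) (M.nextSlot k) (M.beliefStep ω))
    (ha : c ≤ W (min k (Δ + 1)) (M.nextSlot k) M.p11)
    (hn : c ≤ W (Δ + 1) (M.nextSlot k) M.p01) : Δ + α * c ≤ M.bellman α lam W Δ k ω := by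
  have h2 : c ≤ M.transmitValue W Δ k ω := by
    have h3 := mul_le_mul_of_nonneg_left ha hω.1
    have h4 := mul_le_mul_of_nonneg_left hn (sub_nonneg.2 hω.2)
    unfold transmitValue
    linarith
  refine add_le_add le_rfl (le_min (mul_le_mul_of_nonneg_left hs hα0) ?_)
  linarith [mul_le_mul_of_nonneg_left h2 hα0]

theorem valueIter_le_succ (hα0 : 0 ≤ α) (hlam : 0 ≤ lam) (n Δ k : ℕ) {ω : ℝ}
    (hω : ω ∈ Icc (0 : ℝ) 1) :
    M.valueIter α lam n Δ k ω ≤ M.valueIter α lam (n + 1) Δ k ω := by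
  induction n generalizing Δ k ω with
  | zero =>
    have : (Δ : ℝ) + α * 0 ≤ M.bellman α lam (fun _ _ _ => 0) Δ k ω :=
      le_bellman hα0 hlam hω le_rfl le_rfl le_rfl
    refine le_trans ?_ this
    simp [valueIter]
  | succ n ih => exact bellman_mono hα0 (fun Δ k ω hω => ih Δ k hω) Δ k hω

theorem valueIter_mono (hα0 : 0 ≤ α) (hlam : 0 ≤ lam) (Δ k : ℕ) {ω : ℝ}
    (hω : ω ∈ Icc (0 : ℝ) 1) : Monotone fun n => M.valueIter α lam n Δ k ω :=
  monotone_nat_of_le_succ fun n => valueIter_le_succ hα0 hlam n Δ k hω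

theorem valueIter_nonneg (hα0 : 0 ≤ α) (hlam : 0 ≤ lam) (n Δ k : ℕ) {ω : ℝ}
    (hω : ω ∈ Icc (0 : ℝ) 1) : 0 ≤ M.valueIter α lam n Δ k ω :=
  valueIter_mono hα0 hlam Δ k hω n.zero_le

theorem valueIter_regular (hα0 : 0 ≤ α) (hα1 : α ≤ 1) (hlam : 0 ≤ lam) (n : ℕ) :
    Regular lam (M.valueIter α lam n) := by
  induction n with
  | zero => exact Regular.zero hlam
  | succ n ih => exact ih.bellman hlam hα0 hα1

/-- The right-hand side is the discounted cost of suspending forever, the sum of α^i (Δ + i). -/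
theorem valueIter_le (hα0 : 0 ≤ α) (hα1 : α < 1) (n Δ k : ℕ) (ω : ℝ) :
    M.valueIter α lam n Δ k ω ≤ Δ / (1 - α) + α / (1 - α) ^ 2 := by
  have hp : 0 < 1 - α := sub_pos.2 hα1
  induction n generalizing Δ k ω with
  | zero => simp only [valueIter]; positivity
  | succ n ih =>
    refine (bellman_le_suspend _ _ _ _).trans
      ((add_le_add le_rfl (mul_le_mul_of_nonneg_left (ih _ _ _) hα0)).trans_eq ?_)
    push_cast
    field_simp
    ring

theorem tendsto_valueIter (hα0 : 0 ≤ α) (hα1 : α < 1) (hlam : 0 ≤ lam) (Δ k : ℕ) {ω : ℝ}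
    (hω : ω ∈ Icc (0 : ℝ) 1) :
    Tendsto (fun n => M.valueIter α lam n Δ k ω) atTop (𝓝 (M.discountedValue α lam Δ k ω)) :=
  tendsto_atTop_ciSup (valueIter_mono hα0 hlam Δ k hω)
    ⟨_, by rintro _ ⟨n, rfl⟩; exact valueIter_le hα0 hα1 n Δ k ω⟩

theorem discountedValue_regular (hα0 : 0 ≤ α) (hα1 : α < 1) (hlam : 0 ≤ lam) :
    Regular lam (M.discountedValue α lam) :=
  Regular.of_tendsto (Eventually.of_forall fun n => valueIter_regular hα0 hα1.le hlam n)
    fun Δ k _ hω => tendsto_valueIter hα0 hα1 hlam Δ k hω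

theorem tendsto_bellman {ι : Type*} {F : Filter ι} {V : ι → ℕ → ℕ → ℝ → ℝ}
    {W : ℕ → ℕ → ℝ → ℝ} {a : ι → ℝ} (ha : Tendsto a F (𝓝 α))
    (h : ∀ Δ k, ∀ ω ∈ Icc (0 : ℝ) 1, Tendsto (fun i => V i Δ k ω) F (𝓝 (W Δ k ω)))
    (Δ k : ℕ) {ω : ℝ} (hω : ω ∈ Icc (0 : ℝ) 1) :
    Tendsto (fun i => M.bellman (a i) lam (V i) Δ k ω) F (𝓝 (M.bellman α lam W Δ k ω)) :=
  ((ha.mul (h _ _ _ (M.beliefStep_mem hω))).min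
    ((ha.mul (((h _ _ _ M.p11_mem).const_mul ω).add
      ((h _ _ _ M.p01_mem).const_mul (1 - ω)))).const_add lam)).const_add _

theorem discountedValue_eq (hα0 : 0 ≤ α) (hα1 : α < 1) (hlam : 0 ≤ lam) (Δ k : ℕ) {ω : ℝ}
    (hω : ω ∈ Icc (0 : ℝ) 1) :
    M.discountedValue α lam Δ k ω = M.bellman α lam (M.discountedValue α lam) Δ k ω :=
  tendsto_nhds_unique ((tendsto_add_atTop_iff_nat 1).2 (tendsto_valueIter hα0 hα1 hlam Δ k hω))
    (tendsto_bellman tendsto_const_nhds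
      (fun Δ k _ hω => tendsto_valueIter hα0 hα1 hlam Δ k hω) Δ k hω)

theorem discountedValue_nonneg (hα0 : 0 ≤ α) (hα1 : α < 1) (hlam : 0 ≤ lam) (Δ k : ℕ) {ω : ℝ}
    (hω : ω ∈ Icc (0 : ℝ) 1) : 0 ≤ M.discountedValue α lam Δ k ω :=
  ge_of_tendsto' (tendsto_valueIter hα0 hα1 hlam Δ k hω)
    fun n => valueIter_nonneg hα0 hlam n Δ k hω

theorem nextSlot_of_lt {k : ℕ} (h : k < M.K) : M.nextSlot k = k + 1 := by
  rw [nextSlot, Nat.mod_eq_of_lt h]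

theorem nextSlot_K : M.nextSlot M.K = 1 := by
  rw [nextSlot, Nat.mod_self]

variable (M lam) in
/-- Upper bound for the cost of transmitting in every slot until a delivery in the last slot of a
frame, starting right after a failure. -/
def reachBound (Δ k : ℕ) : ℝ :=
  Δ * M.p01⁻¹ + (M.K - k) * (lam + M.K + M.p01⁻¹) + M.K * (lam + M.K + M.p01⁻¹) * M.p01⁻¹

theorem reachBound_nonneg (hlam : 0 ≤ lam) (Δ : ℕ) {k : ℕ} (hk : k ≤ M.K) :
    0 ≤ M.reachBound lam Δ k := by
  have h1 : (k : ℝ) ≤ M.K := by exact_mod_cast hk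
  have h2 := inv_nonneg.2 M.p01_nonneg
  have h3 := sub_nonneg.2 h1
  unfold reachBound
  positivity

/-- A success in slot K ends the excursion, so only failure continues. It has probability 1 - p01,
which lowers the last term of `reachBound` by K (lam + K + 1/p01), the budget of a whole new frame.
-/
theorem reachBound_last (hp : 0 < M.p01) (hlam : 0 ≤ lam) (Δ : ℕ) :
    Δ + lam + (1 - M.p01) * M.reachBound lam (Δ + 1) 1 ≤ M.reachBound lam Δ M.K := by
  have h1 : (1 : ℝ) ≤ M.K := by exact_mod_cast M.one_le_K
  have hA : M.p01 * M.p01⁻¹ = 1 := mul_inv_cancel₀ hp.ne'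
  have hA0 := inv_pos.2 hp
  unfold reachBound
  set A := M.p01⁻¹
  set C := lam + M.K + A with hC
  have hC0 : 0 ≤ C := by positivity
  have h2 : 0 ≤ M.p01 * ((M.K - 1) * C) := mul_nonneg hp.le (mul_nonneg (sub_nonneg.2 h1) hC0)
  push_cast
  linear_combination h2 + h1 - (Δ + 1 + M.K * C) * hA + hC

/-- Inside a frame each slot uses up one unit lam + K + 1/p01 of the middle term; the current age is
paid for by the drop of Δ/p01 on success. -/
theorem reachBound_of_lt (hp : 0 < M.p01) {k : ℕ} (hk : k < M.K) (Δ : ℕ) :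
    Δ + lam + M.p01 * M.reachBound lam k (k + 1) + (1 - M.p01) * M.reachBound lam (Δ + 1) (k + 1) ≤
      M.reachBound lam Δ k := by
  have h1 : (k : ℝ) ≤ M.K := by exact_mod_cast hk.le
  have hA : M.p01 * M.p01⁻¹ = 1 := mul_inv_cancel₀ hp.ne'
  unfold reachBound
  set A := M.p01⁻¹
  push_cast
  linear_combination h1 + (k - Δ - 1) * hA

theorem valueIter_le_reachBound (hp : 0 < M.p01) (hα0 : 0 ≤ α) (hα1 : α ≤ 1) (hlam : 0 ≤ lam)
    (n Δ : ℕ) {k : ℕ} (hk : k ∈ Icc 1 M.K) :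
    M.valueIter α lam n Δ k M.p01 ≤
      M.valueIter α lam n M.K 1 M.p11 + M.reachBound lam Δ k := by
  induction n generalizing Δ k with
  | zero => simpa [valueIter] using reachBound_nonneg hlam Δ hk.2
  | succ n ih =>
    have hreg := valueIter_regular (M := M) hα0 hα1 hlam n
    have hr := valueIter_le_succ (M := M) hα0 hlam n M.K 1 M.p11_mem
    have hr0 := valueIter_nonneg (M := M) hα0 hlam n M.K 1 M.p11_mem
    have hT0 : 0 ≤ M.transmitValue (M.valueIter α lam n) Δ k M.p01 :=
      add_nonneg (mul_nonneg hp.le (valueIter_nonneg hα0 hlam _ _ _ M.p11_mem))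
        (mul_nonneg (sub_nonneg.2 M.p01_mem.2) (valueIter_nonneg hα0 hlam _ _ _ M.p01_mem))
    refine (bellman_le_transmit _ _ _ _).trans ?_
    have h1 := mul_le_of_le_one_left hT0 hα1
    have h2 := mul_le_mul_of_nonneg_left (ih (Δ + 1) (M.nextSlot_mem k))
      (sub_nonneg.2 M.p01_mem.2)
    have h3 : M.valueIter α lam n (min k (Δ + 1)) (M.nextSlot k) M.p11 ≤
        M.valueIter α lam n k (M.nextSlot k) M.p11 :=
      hreg.age_mono _ _ M.p11_mem (min_le_left _ _)
    rcases hk.2.lt_or_eq with hlt | rfl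
    -- A success before the last slot does not reach the reference state; its belief p11 is lowered
    -- to p01 so that the induction hypothesis applies again.
    · have h4 := hreg.belief_anti k (M.nextSlot k) M.p01_mem M.p11_mem M.p01_le_p11
      have h5 := mul_le_mul_of_nonneg_left (h3.trans (h4.trans (ih k (M.nextSlot_mem k)))) hp.le
      have h6 := reachBound_of_lt (lam := lam) hp hlt Δ
      rw [← nextSlot_of_lt hlt] at h6
      unfold transmitValue at h1 ⊢
      linarith
    · rw [nextSlot_K] at h2 h3
      have h5 := mul_le_mul_of_nonneg_left h3 hp.le
      have h6 := reachBound_last hp hlam Δ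
      unfold transmitValue at h1 ⊢
      rw [nextSlot_K] at h1 ⊢
      linarith

/-- One suspension moves an arbitrary k into 1, …, K and makes the belief at least p01, where the
previous bound applies. -/
theorem discountedValue_le_reachBound (hp : 0 < M.p01) (hα0 : 0 ≤ α) (hα1 : α < 1)
    (hlam : 0 ≤ lam) (Δ k : ℕ) {ω : ℝ} (hω : ω ∈ Icc (0 : ℝ) 1) :
    M.discountedValue α lam Δ k ω ≤
      Δ + α * (M.discountedValue α lam M.K 1 M.p11 + M.reachBound lam (Δ + 1) (M.nextSlot k)) := by
  rw [discountedValue_eq hα0 hα1 hlam Δ k hω]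
  refine (bellman_le_suspend _ _ _ _).trans (add_le_add le_rfl (mul_le_mul_of_nonneg_left ?_ hα0))
  refine ((discountedValue_regular hα0 hα1 hlam).belief_anti _ _ M.p01_mem (M.beliefStep_mem hω)
    (M.le_beliefStep hω.1)).trans ?_
  exact le_of_tendsto_of_tendsto' (tendsto_valueIter hα0 hα1 hlam _ _ M.p01_mem)
    ((tendsto_valueIter hα0 hα1 hlam _ _ M.p11_mem).add_const _)
    fun n => valueIter_le_reachBound hp hα0 hα1.le hlam n _ (M.nextSlot_mem k)

/-- Backward induction from the end of the frame. The switch `v` turns on the invariant slot ≤ age +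
1, which both actions preserve within the frame and which makes the age at least K on entering slot
1. The belief is then at most p11. -/
theorem discountedValue_ge_of_first_slot (hα0 : 0 ≤ α) (hα1 : α < 1) (hlam : 0 ≤ lam) {c : ℝ}
    {v : Prop}
    (h : ∀ Δ : ℕ, (v → M.K ≤ Δ) → ∀ ω ∈ Icc (0 : ℝ) M.p11, c ≤ M.discountedValue α lam Δ 1 ω)
    {j : ℕ} (hj : j < M.K) (Δ : ℕ) (hΔ : v → M.K - j ≤ Δ + 1) {ω : ℝ} (hω : ω ∈ Icc (0 : ℝ) 1) :
    α ^ (j + 1) * c ≤ M.discountedValue α lam Δ (M.K - j) ω := by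
  induction j generalizing Δ ω with
  | zero =>
    rw [discountedValue_eq hα0 hα1 hlam _ _ hω]
    refine le_trans ?_ (le_bellman (c := c) hα0 hlam hω ?_ ?_ ?_)
    · simp
    all_goals rw [Nat.sub_zero, nextSlot_K]; refine h _ (fun hv => ?_) _ ?_
    · simpa using hΔ hv
    · exact ⟨(M.beliefStep_mem hω).1, M.beliefStep_le hω.2⟩
    · simpa using hΔ hv
    · exact ⟨M.p11_mem.1, le_rfl⟩
    · simpa using hΔ hv
    · exact ⟨M.p01_nonneg, M.p01_le_p11⟩
  | succ j ih =>
    have e : M.nextSlot (M.K - (j + 1)) = M.K - j := by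
      rw [nextSlot_of_lt (by omega)]
      omega
    rw [discountedValue_eq hα0 hα1 hlam _ _ hω]
    refine le_trans ?_ (le_bellman (c := α ^ (j + 1) * c) hα0 hlam hω ?_ ?_ ?_)
    · rw [pow_succ' α (j + 1), mul_assoc]
      exact le_add_of_nonneg_left (Nat.cast_nonneg _)
    all_goals
      rw [e]
      refine ih (by omega) _ (fun hv => ?_) ?_
    · have := hΔ hv; omega
    · exact M.beliefStep_mem hω
    · have := hΔ hv; omega
    · exact M.p11_mem
    · have := hΔ hv; omega
    · exact M.p01_mem

/-- By monotonicity the reference is cheapest among slot 1 states with age at least K and belief at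
most p11. One frame leads there from any slot 1 state, at most K slots lead to slot 1, and one more
slot brings an arbitrary k into range: 2K + 1 in all. -/
theorem discountedValue_ge (hα0 : 0 ≤ α) (hα1 : α < 1) (hlam : 0 ≤ lam) (Δ k : ℕ) {ω : ℝ}
    (hω : ω ∈ Icc (0 : ℝ) 1) :
    α ^ (2 * M.K + 1) * M.discountedValue α lam M.K 1 M.p11 ≤ M.discountedValue α lam Δ k ω := by
  have hK := M.one_le_K
  have hreg := discountedValue_regular (M := M) hα0 hα1 hlam
  set r := M.discountedValue α lam M.K 1 M.p11 with hr
  have hr0 : 0 ≤ r := discountedValue_nonneg hα0 hα1 hlam _ _ M.p11_mem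
  have h1 : ∀ (Δ : ℕ), ∀ ω ∈ Icc (0 : ℝ) 1, α ^ M.K * r ≤ M.discountedValue α lam Δ 1 ω := by
    intro Δ ω hω
    have := discountedValue_ge_of_first_slot (M := M) (c := r) (v := True) hα0 hα1 hlam
      (fun Δ hΔ ω hω => (hreg.age_mono 1 M.p11 M.p11_mem (hΔ trivial)).trans
        (hreg.belief_anti Δ 1 ⟨hω.1, hω.2.trans M.p11_le_one⟩ M.p11_mem hω.2))
      (j := M.K - 1) (by omega) Δ (fun _ => by omega) hω
    rwa [Nat.sub_add_cancel hK, Nat.sub_sub_self hK] at this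
  have h2 : ∀ Δ : ℕ, ∀ k ∈ Icc 1 M.K, ∀ ω ∈ Icc (0 : ℝ) 1,
      α ^ (2 * M.K) * r ≤ M.discountedValue α lam Δ k ω := by
    intro Δ k hk ω hω
    have := discountedValue_ge_of_first_slot (M := M) (c := α ^ M.K * r) (v := False) hα0 hα1 hlam
      (fun Δ _ ω hω => h1 Δ ω ⟨hω.1, hω.2.trans M.p11_le_one⟩)
      (j := M.K - k) (by have := hk.1; omega) Δ (fun h => h.elim) hω
    rw [Nat.sub_sub_self hk.2, ← mul_assoc, ← pow_add] at this
    refine le_trans (mul_le_mul_of_nonneg_right ?_ hr0) this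
    exact pow_le_pow_of_le_one hα0 hα1.le (by have := hk.1; omega)
  rw [discountedValue_eq hα0 hα1 hlam _ _ hω]
  refine le_trans ?_ (le_bellman (c := α ^ (2 * M.K) * r) hα0 hlam hω
    (h2 _ _ (M.nextSlot_mem k) _ (M.beliefStep_mem hω)) (h2 _ _ (M.nextSlot_mem k) _ M.p11_mem)
    (h2 _ _ (M.nextSlot_mem k) _ M.p01_mem))
  rw [pow_succ', mul_assoc]
  exact le_add_of_nonneg_left (Nat.cast_nonneg _)

variable (M lam) in
/-- Uniform bound on the normalized discounted cost `(1 - α) V_α` of the reference state. -/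
def gainBound : ℝ := M.K + M.reachBound lam (M.K + 1) (M.nextSlot 1)

theorem gainBound_spec (hp : 0 < M.p01) (hα0 : 0 ≤ α) (hα1 : α < 1) (hlam : 0 ≤ lam) :
    (1 - α) * M.discountedValue α lam M.K 1 M.p11 ≤ M.gainBound lam := by
  have h1 := discountedValue_le_reachBound hp hα0 hα1 hlam M.K 1 M.p11_mem
  have h2 := mul_le_of_le_one_left
    (reachBound_nonneg hlam (M.K + 1) (M.nextSlot_mem 1).2) hα1.le
  unfold gainBound
  linarith

theorem sub_discountedValue_le (hp : 0 < M.p01) (hα0 : 0 ≤ α) (hα1 : α < 1) (hlam : 0 ≤ lam)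
    (Δ k : ℕ) {ω : ℝ} (hω : ω ∈ Icc (0 : ℝ) 1) :
    M.discountedValue α lam Δ k ω - M.discountedValue α lam M.K 1 M.p11 ≤
      Δ + M.reachBound lam (Δ + 1) (M.nextSlot k) := by
  have h1 := discountedValue_le_reachBound hp hα0 hα1 hlam Δ k hω
  have h2 := mul_le_of_le_one_left (add_nonneg
    (discountedValue_nonneg (M := M) hα0 hα1 hlam M.K 1 M.p11_mem)
    (reachBound_nonneg hlam (Δ + 1) (M.nextSlot_mem k).2)) hα1.le
  linarith

/-- Bernoulli's inequality turns the factor α^(2K+1) into a loss of at most (2K + 1)(1 - α) times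
the reference value, which `gainBound` controls. -/
theorem le_sub_discountedValue (hp : 0 < M.p01) (hα0 : 0 ≤ α) (hα1 : α < 1) (hlam : 0 ≤ lam)
    (Δ k : ℕ) {ω : ℝ} (hω : ω ∈ Icc (0 : ℝ) 1) :
    -((2 * M.K + 1 : ℕ) * M.gainBound lam) ≤
      M.discountedValue α lam Δ k ω - M.discountedValue α lam M.K 1 M.p11 := by
  have h1 := discountedValue_ge (M := M) hα0 hα1 hlam Δ k hω
  have h2 := mul_le_mul_of_nonneg_left (gainBound_spec hp hα0 hα1 hlam)
    (Nat.cast_nonneg (α := ℝ) (2 * M.K + 1))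
  have h3 := mul_le_mul_of_nonneg_right
    (one_add_mul_le_pow (show (-2 : ℝ) ≤ α - 1 by linarith) (2 * M.K + 1))
    (discountedValue_nonneg (M := M) hα0 hα1 hlam M.K 1 M.p11_mem)
  rw [add_sub_cancel] at h3
  linarith

theorem exists_relativeValue (M : AoIModel) (hp : 0 < M.p01) (hlam : 0 ≤ lam) :
    ∃ (F : Filter ℝ) (g L : ℝ) (h : ℕ → ℕ → ℝ → ℝ), F.NeBot ∧ F ≤ 𝓝[<] 1 ∧ 0 ≤ g ∧
      Regular lam h ∧
      (∀ Δ k, ∀ ω ∈ Icc (0 : ℝ) 1, g + h Δ k ω = M.bellman 1 lam h Δ k ω) ∧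
      (∀ Δ k, ∀ ω ∈ Icc (0 : ℝ) 1, -L ≤ h Δ k ω) ∧
      ∀ Δ k, ∀ ω ∈ Icc (0 : ℝ) 1,
        Tendsto (fun α => (1 - α) * M.discountedValue α lam Δ k ω) F (𝓝 g) := by
  -- Bounded functions of α converge along an ultrafilter, so one choice serves all (Δ, k, ω) and
  -- replaces a diagonal subsequence.
  let F : Ultrafilter ℝ := Ultrafilter.of (𝓝[<] 1)
  have hF : (F : Filter ℝ) ≤ 𝓝[<] 1 := Ultrafilter.of_le _
  have hF1 : Tendsto (fun α : ℝ => α) F (𝓝 1) := hF.trans nhdsWithin_le_nhds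
  have hev : ∀ᶠ α in (F : Filter ℝ), 0 ≤ α ∧ α < 1 :=
    hF (Filter.inter_mem (mem_nhdsWithin_of_mem_nhds (Ici_mem_nhds zero_lt_one))
      self_mem_nhdsWithin)
  have key : ∀ (f : ℝ → ℝ) (a b : ℝ), (∀ α, 0 ≤ α ∧ α < 1 → f α ∈ Icc a b) →
      ∃ x ∈ Icc a b, Tendsto f F (𝓝 x) := by
    intro f a b hf
    exact isCompact_Icc.ultrafilter_le_nhds (F.map f)
      (le_principal_iff.2 (hev.mono hf))
  obtain ⟨g, hg, hgF⟩ := key (fun α => (1 - α) * M.discountedValue α lam M.K 1 M.p11) 0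
    (M.gainBound lam) fun α hα => ⟨mul_nonneg (sub_nonneg.2 hα.2.le)
      (discountedValue_nonneg hα.1 hα.2 hlam _ _ M.p11_mem), gainBound_spec hp hα.1 hα.2 hlam⟩
  have hex : ∀ (Δ k : ℕ) (ω : ℝ), ∃ x, ω ∈ Icc (0 : ℝ) 1 →
      -((2 * M.K + 1 : ℕ) * M.gainBound lam) ≤ x ∧
      Tendsto (fun α => M.discountedValue α lam Δ k ω - M.discountedValue α lam M.K 1 M.p11)
        F (𝓝 x) := by
    intro Δ k ω
    by_cases hω : ω ∈ Icc (0 : ℝ) 1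
    · obtain ⟨x, hx, hxF⟩ := key _ _ _ fun α hα =>
        ⟨le_sub_discountedValue hp hα.1 hα.2 hlam Δ k hω,
          sub_discountedValue_le hp hα.1 hα.2 hlam Δ k hω⟩
      exact ⟨x, fun _ => ⟨hx.1, hxF⟩⟩
    · exact ⟨0, fun h => absurd h hω⟩
  choose h hh using hex
  refine ⟨F, g, (2 * M.K + 1 : ℕ) * M.gainBound lam, h, inferInstance, hF, hg.1, ?_, ?_,
    fun Δ k ω hω => (hh Δ k ω hω).1, ?_⟩
  · exact Regular.of_tendsto
      (hev.mono fun α hα => (discountedValue_regular hα.1 hα.2 hlam).sub_const _)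
      fun Δ k ω hω => (hh Δ k ω hω).2
  · intro Δ k ω hω
    refine tendsto_nhds_unique (hgF.add (hh Δ k ω hω).2)
      ((tendsto_bellman hF1 (fun Δ k ω hω => (hh Δ k ω hω).2) Δ k hω).congr' ?_)
    filter_upwards [hev] with α hα
    have e := discountedValue_eq (M := M) hα.1 hα.2 hlam Δ k hω
    set r := M.discountedValue α lam M.K 1 M.p11
    have e1 : M.bellman α lam (fun Δ k ω => M.discountedValue α lam Δ k ω - r) Δ k ω =
        M.bellman α lam (M.discountedValue α lam) Δ k ω - α * r := by
      simp only [bellman]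
      rw [add_sub_assoc, ← min_sub_sub_right]
      congr 2 <;> simp only [suspendValue, transmitValue] <;> ring
    rw [e1, ← e]
    ring
  · intro Δ k ω hω
    have h0 : Tendsto (fun α : ℝ => 1 - α) F (𝓝 0) := by
      simpa using hF1.const_sub 1
    have := hgF.add (h0.mul (hh Δ k ω hω).2)
    rw [zero_mul, add_zero] at this
    refine this.congr fun α => ?_
    ring

end

/-! ### Expectations under policies and bounds on the average cost -/

section

/-- Expectation of a nonnegative function. -/
def mean {X : Type*} (p : PMF X) (φ : X → ℝ≥0∞) : ℝ≥0∞ := ∑' x, p x * φ x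

section Mean

variable {X Y : Type*}

theorem mean_pure (a : X) (φ : X → ℝ≥0∞) : mean (PMF.pure a) φ = φ a := by
  classical
  rw [mean, tsum_eq_single a fun b hb => by simp [PMF.pure_apply, hb]]
  simp [PMF.pure_apply]

theorem mean_bind (p : PMF X) (f : X → PMF Y) (φ : Y → ℝ≥0∞) :
    mean (p.bind f) φ = mean p fun x => mean (f x) φ := by
  simp only [mean, PMF.bind_apply, ← ENNReal.tsum_mul_right, ← ENNReal.tsum_mul_left, mul_assoc]
  exact ENNReal.tsum_comm

theorem mean_map (p : PMF X) (f : X → Y) (φ : Y → ℝ≥0∞) :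
    mean (p.map f) φ = mean p fun x => φ (f x) := by
  rw [PMF.map, mean_bind]
  simp only [Function.comp_apply, mean_pure]

theorem mean_add (p : PMF X) (φ ψ : X → ℝ≥0∞) :
    (mean p fun x => φ x + ψ x) = mean p φ + mean p ψ := by
  simp only [mean, mul_add]
  exact ENNReal.tsum_add

theorem mean_const (p : PMF X) (c : ℝ≥0∞) : (mean p fun _ => c) = c := by
  rw [mean, ENNReal.tsum_mul_right, p.tsum_coe, one_mul]

theorem mean_const_mul (p : PMF X) (c : ℝ≥0∞) (φ : X → ℝ≥0∞) :
    (mean p fun x => c * φ x) = c * mean p φ := by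
  simp only [mean, ← ENNReal.tsum_mul_left, mul_left_comm]

theorem mean_mono (p : PMF X) {φ ψ : X → ℝ≥0∞} (h : ∀ x, φ x ≤ ψ x) : mean p φ ≤ mean p ψ :=
  ENNReal.tsum_le_tsum fun x => mul_le_mul_right (h x) _

theorem le_mean (p : PMF X) {φ : X → ℝ≥0∞} {c : ℝ≥0∞} (h : ∀ x, c ≤ φ x) : c ≤ mean p φ :=
  (mean_const p c).symm.le.trans (mean_mono p h)

end Mean

variable {M : AoIModel}

theorem State.belief_mem' (s : M.State) : s.belief ∈ Icc (0 : ℝ) 1 :=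
  M.belief_mem_Icc s.belief_mem

theorem prevSlot_of_two_le {k : ℕ} (h2 : 2 ≤ k) (hk : k ≤ M.K) : M.prevSlot k = k - 1 := by
  rw [prevSlot, show M.K + k - 2 = (k - 2) + M.K by omega, Nat.add_mod_right,
    Nat.mod_eq_of_lt (by omega)]
  omega

theorem prevSlot_one : M.prevSlot 1 = M.K := by
  have := M.one_le_K
  rw [prevSlot, Nat.mod_eq_of_lt (by omega)]
  omega

theorem State.slot_le (s : M.State) : s.slot ≤ s.age + 1 := by
  obtain ⟨m, hm⟩ := s.age_mem
  obtain ⟨h1, h2⟩ := s.slot_mem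
  rcases h1.lt_or_eq with h | h
  · rw [prevSlot_of_two_le h h2] at hm
    omega
  · omega

theorem State.slot_eq (s : M.State) (h : s.age < M.K) : s.slot = s.age + 1 := by
  obtain ⟨m, hm⟩ := s.age_mem
  obtain ⟨h1, h2⟩ := s.slot_mem
  have hm0 : m = 0 := by
    by_contra h0
    have := Nat.le_mul_of_pos_left M.K (Nat.pos_of_ne_zero h0)
    omega
  subst hm0
  rcases h1.lt_or_eq with h3 | h3
  · rw [prevSlot_of_two_le h3 h2] at hm
    omega
  · rw [← h3, prevSlot_one] at hm
    omega

/-- Evaluation of a function of (age, slot, belief) at a state. -/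
def State.eval (W : ℕ → ℕ → ℝ → ℝ) (s : M.State) : ℝ := W s.age s.slot s.belief

theorem mean_transition_suspend (s : M.State) (φ : M.State → ℝ≥0∞) :
    mean (transition s false) φ = φ s.suspended := by
  simp [transition, obsLaw, mean_map, mean_pure, State.next]

theorem mean_transition_transmit (s : M.State) (φ : M.State → ℝ≥0∞) :
    mean (transition s true) φ =
      ENNReal.ofReal s.belief * φ s.ack + ENNReal.ofReal (1 - s.belief) * φ s.nack := by
  rw [transition, mean_map, mean, tsum_bool, add_comm]
  have h : (1 : ℝ≥0∞) - ENNReal.ofReal s.belief = ENNReal.ofReal (1 - s.belief) := by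
    rw [ENNReal.ofReal_sub _ s.belief_mem'.1, ENNReal.ofReal_one]
  simp only [obsLaw, if_true, State.next, ← h]
  congr 1

theorem mean_transition_suspend_ofReal (W : ℕ → ℕ → ℝ → ℝ) (s : M.State) :
    (mean (transition s false) fun s' => ENNReal.ofReal (s'.eval W)) =
      ENNReal.ofReal (s.eval (M.suspendValue W)) :=
  mean_transition_suspend s _

theorem mean_transition_transmit_ofReal {W : ℕ → ℕ → ℝ → ℝ}
    (hW : ∀ Δ k, ∀ ω ∈ Icc (0 : ℝ) 1, 0 ≤ W Δ k ω) (s : M.State) :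
    (mean (transition s true) fun s' => ENNReal.ofReal (s'.eval W)) =
      ENNReal.ofReal (s.eval (M.transmitValue W)) := by
  have h1 := s.belief_mem'.1
  have h2 := sub_nonneg.2 s.belief_mem'.2
  have h3 : 0 ≤ s.ack.eval W := hW _ _ _ s.ack.belief_mem'
  have h4 : 0 ≤ s.nack.eval W := hW _ _ _ s.nack.belief_mem'
  rw [mean_transition_transmit, ← ENNReal.ofReal_mul h1, ← ENNReal.ofReal_mul h2,
    ← ENNReal.ofReal_add (mul_nonneg h1 h3) (mul_nonneg h2 h4)]
  simp only [State.eval, transmitValue, State.ack, State.nack, min_eq_left s.slot_le]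

theorem coe_cost (lam : ℝ≥0) (s : M.State) (u : Bool) :
    (cost lam s u : ℝ≥0∞) = ENNReal.ofReal (s.age + if u then (lam : ℝ) else 0) := by
  rw [cost, ENNReal.coe_nnreal_eq]
  cases u <;> simp

theorem ofReal_bellman_le {α : ℝ} (hα0 : 0 ≤ α) (lam : ℝ≥0) {W : ℕ → ℕ → ℝ → ℝ}
    (hW : ∀ Δ k, ∀ ω ∈ Icc (0 : ℝ) 1, 0 ≤ W Δ k ω) (s : M.State) (u : Bool) :
    ENNReal.ofReal (s.eval (M.bellman α lam W)) ≤
      cost lam s u +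
        ENNReal.ofReal α * mean (transition s u) fun s' => ENNReal.ofReal (s'.eval W) := by
  have hs : 0 ≤ s.eval (M.suspendValue W) := hW _ _ _ (M.beliefStep_mem s.belief_mem')
  have ht : 0 ≤ s.eval (M.transmitValue W) :=
    add_nonneg (mul_nonneg s.belief_mem'.1 (hW _ _ _ M.p11_mem))
      (mul_nonneg (sub_nonneg.2 s.belief_mem'.2) (hW _ _ _ M.p01_mem))
  rw [coe_cost]
  cases u
  · rw [mean_transition_suspend_ofReal, ← ENNReal.ofReal_mul hα0,
      ← ENNReal.ofReal_add (by simp) (mul_nonneg hα0 hs)]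
    refine ENNReal.ofReal_le_ofReal ?_
    have := bellman_le_suspend (M := M) (α := α) (lam := lam) W s.age s.slot s.belief
    simpa [State.eval, suspendValue] using this
  · rw [mean_transition_transmit_ofReal hW, ← ENNReal.ofReal_mul hα0,
      ← ENNReal.ofReal_add (by simp; positivity) (mul_nonneg hα0 ht)]
    refine ENNReal.ofReal_le_ofReal ?_
    have := bellman_le_transmit (M := M) (α := α) (lam := lam) W s.age s.slot s.belief
    simpa [State.eval, add_assoc] using this

theorem mean_pathLaw_succ (π : M.Policy) (s₁ : M.State) (t : ℕ)
    (φ : M.History × M.State → ℝ≥0∞) :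
    mean (pathLaw π s₁ (t + 1)) φ = mean (pathLaw π s₁ t) fun x => mean (π x.1 x.2) fun u =>
      mean (transition x.2 u) fun s' => φ ((x.2, u) :: x.1, s') := by
  simp only [pathLaw, mean_bind, mean_map]

/-- Expected cost of slot `t + 1`. -/
def stageCost (lam : ℝ≥0) (π : M.Policy) (s₁ : M.State) (t : ℕ) : ℝ≥0∞ :=
  mean (pathLaw π s₁ t) fun x => mean (π x.1 x.2) fun u => (cost lam x.2 u : ℝ≥0∞)

theorem expectedCost_zero (lam : ℝ≥0) (π : M.Policy) (s₁ : M.State) :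
    expectedCost lam π s₁ 0 = 0 :=
  (mean_pure _ _).trans (by simp [totalCost])

theorem expectedCost_succ (lam : ℝ≥0) (π : M.Policy) (s₁ : M.State) (t : ℕ) :
    expectedCost lam π s₁ (t + 1) = expectedCost lam π s₁ t + stageCost lam π s₁ t := by
  change mean (pathLaw π s₁ (t + 1)) (fun x => (totalCost lam x.1 : ℝ≥0∞)) =
    mean (pathLaw π s₁ t) (fun x => (totalCost lam x.1 : ℝ≥0∞)) + _
  rw [mean_pathLaw_succ, stageCost, add_comm, ← mean_add]
  congr 1
  ext x
  simp only [totalCost, List.map_cons, List.sum_cons, ENNReal.coe_add, mean_const, mean_add]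

/-- Unrolls the Bellman minimum along t slots of π: a minimum is at most any average over actions,
whatever the history. The remaining horizon m grows in the induction. -/
theorem ofReal_valueIter_le {α : ℝ} (hα0 : 0 ≤ α) (lam : ℝ≥0) (π : M.Policy)
    (s₁ : M.State) (m t : ℕ) :
    ENNReal.ofReal (s₁.eval (M.valueIter α lam (m + t))) ≤
      ∑ i ∈ Finset.range t, ENNReal.ofReal α ^ i * stageCost lam π s₁ i +
        ENNReal.ofReal α ^ t *
          mean (pathLaw π s₁ t) fun x => ENNReal.ofReal (x.2.eval (M.valueIter α lam m)) := by
  induction t generalizing m with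
  | zero => simp [pathLaw, mean_pure]
  | succ t ih =>
    rw [show m + (t + 1) = (m + 1) + t by omega]
    refine (ih (m + 1)).trans ?_
    rw [Finset.sum_range_succ, add_assoc]
    refine add_le_add le_rfl ?_
    rw [pow_succ, mul_assoc, ← mul_add]
    refine mul_le_mul_right ?_ _
    rw [mean_pathLaw_succ, stageCost, ← mean_const_mul, ← mean_add]
    refine mean_mono _ fun x => ?_
    rw [← mean_const_mul, ← mean_add]
    exact le_mean _ fun u => ofReal_bellman_le hα0 lam
      (fun Δ k ω hω => valueIter_nonneg hα0 lam.2 m Δ k hω) x.2 u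

theorem ofReal_valueIter_le_sum {α : ℝ} (hα0 : 0 ≤ α) (lam : ℝ≥0) (π : M.Policy)
    (s₁ : M.State) (n : ℕ) :
    ENNReal.ofReal (s₁.eval (M.valueIter α lam n)) ≤
      ∑ i ∈ Finset.range n, ENNReal.ofReal α ^ i * stageCost lam π s₁ i := by
  have h := ofReal_valueIter_le hα0 lam π s₁ 0 n
  have h0 : (fun x : M.History × M.State => ENNReal.ofReal (x.2.eval (M.valueIter α lam 0))) =
      fun _ => 0 := by
    ext x
    simp [State.eval, valueIter]
  rw [h0, mean_const, mul_zero, add_zero, zero_add] at h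
  exact h

theorem sum_stageCost (lam : ℝ≥0) (π : M.Policy) (s₁ : M.State) (n : ℕ) :
    ∑ i ∈ Finset.range n, stageCost lam π s₁ i = expectedCost lam π s₁ n := by
  induction n with
  | zero => rw [expectedCost_zero, Finset.sum_range_zero]
  | succ n ih => rw [Finset.sum_range_succ, ih, expectedCost_succ]

theorem ofReal_valueIter_one_le (lam : ℝ≥0) (π : M.Policy) (s₁ : M.State) (n : ℕ) :
    ENNReal.ofReal (s₁.eval (M.valueIter 1 lam n)) ≤ expectedCost lam π s₁ n := by
  simpa [sum_stageCost] using ofReal_valueIter_le_sum zero_le_one lam π s₁ n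

/-- Telescoping; the terminal term is dropped because H is nonnegative. H need only be finite at the
start, which the frozen channel exploits. -/
theorem averageCost_stationary_le (lam : ℝ≥0) {d : M.State → Bool} {g : ℝ≥0∞}
    {H : M.State → ℝ≥0∞}
    (hH : ∀ s, cost lam s (d s) + mean (transition s (d s)) H ≤ g + H s)
    {s₁ : M.State} (hs : H s₁ ≠ ⊤) : averageCost lam (stationary d) s₁ ≤ g := by
  have key : ∀ T : ℕ, expectedCost lam (stationary d) s₁ T +
      mean (pathLaw (stationary d) s₁ T) (fun x => H x.2) ≤ T * g + H s₁ := by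
    intro T
    induction T with
    | zero => simp [expectedCost_zero, pathLaw, mean_pure]
    | succ T ih =>
      rw [expectedCost_succ, mean_pathLaw_succ, stageCost, add_assoc, ← mean_add]
      have h1 : (mean (pathLaw (stationary d) s₁ T) fun x =>
          (mean (stationary d x.1 x.2) fun u => (cost lam x.2 u : ℝ≥0∞)) +
            mean (stationary d x.1 x.2) fun u => mean (transition x.2 u) fun s' => H s') ≤
          g + mean (pathLaw (stationary d) s₁ T) fun x => H x.2 := by
        rw [← mean_const (pathLaw (stationary d) s₁ T) g, ← mean_add]
        refine mean_mono _ fun x => ?_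
        simp only [stationary, mean_pure]
        exact hH x.2
      calc _ ≤ expectedCost lam (stationary d) s₁ T +
            (g + mean (pathLaw (stationary d) s₁ T) fun x => H x.2) := add_le_add le_rfl h1
        _ = g + (expectedCost lam (stationary d) s₁ T +
            mean (pathLaw (stationary d) s₁ T) fun x => H x.2) := by ring
        _ ≤ g + (T * g + H s₁) := add_le_add le_rfl ih
        _ = (T + 1 : ℕ) * g + H s₁ := by push_cast; ring
  have hlim : Tendsto (fun T : ℕ => g + H s₁ / (T : ℝ≥0∞)) atTop (𝓝 (g + 0)) :=
    tendsto_const_nhds.add (ENNReal.Tendsto.const_div ENNReal.tendsto_nat_nhds_top (Or.inr hs)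
      |>.trans (by simp))
  rw [add_zero] at hlim
  rw [← hlim.limsup_eq]
  refine limsup_le_limsup ?_
  filter_upwards [eventually_gt_atTop 0] with T hT
  have hT0 : (T : ℝ≥0∞) ≠ 0 := by exact_mod_cast hT.ne'
  rw [ENNReal.div_le_iff hT0 (ENNReal.natCast_ne_top T), add_mul,
    ENNReal.div_mul_cancel hT0 (ENNReal.natCast_ne_top T), mul_comm g]
  exact le_self_add.trans (key T)

/-- Summation by parts without subtraction: D t is the slack in `h t`, and the induction carries a^n
D n. -/
theorem discounted_sum_le {c : ℕ → ℝ≥0∞} {C L : ℝ≥0∞} (hC : C ≠ ⊤) (hL : L ≠ ⊤)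
    (h : ∀ t : ℕ, ∑ i ∈ Finset.range t, c i ≤ C + t * L) {a : ℝ≥0∞} (ha : a ≤ 1) (n : ℕ) :
    ∑ i ∈ Finset.range n, a ^ i * c i ≤ C + L * ∑ i ∈ Finset.range n, a ^ i := by
  choose D hD using fun t => exists_add_of_le (h t)
  have hstep : ∀ n, c n + D (n + 1) = D n + L := by
    intro n
    have hfin : ∑ i ∈ Finset.range n, c i ≠ ⊤ := ne_top_of_le_ne_top
      (ENNReal.add_ne_top.2 ⟨hC, ENNReal.mul_ne_top (ENNReal.natCast_ne_top n) hL⟩) (h n)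
    have h1 := hD (n + 1)
    rw [Finset.sum_range_succ, Nat.cast_succ, add_mul, one_mul, ← add_assoc, hD n] at h1
    rw [add_assoc, add_assoc] at h1
    exact ((ENNReal.add_right_inj hfin).1 h1).symm
  suffices ∑ i ∈ Finset.range n, a ^ i * c i + a ^ n * D n ≤
      C + L * ∑ i ∈ Finset.range n, a ^ i from le_self_add.trans this
  induction n with
  | zero => simpa using (hD 0).symm.le
  | succ n ih =>
    rw [Finset.sum_range_succ, Finset.sum_range_succ, add_assoc]
    calc _ ≤ ∑ i ∈ Finset.range n, a ^ i * c i + (a ^ n * c n + a ^ n * D (n + 1)) :=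
          add_le_add le_rfl (add_le_add le_rfl
            (mul_le_mul_left (pow_le_pow_right_of_le_one' ha n.le_succ) _))
      _ = (∑ i ∈ Finset.range n, a ^ i * c i + a ^ n * D n) + L * a ^ n := by
          rw [← mul_add, hstep]
          ring
      _ ≤ (C + L * ∑ i ∈ Finset.range n, a ^ i) + L * a ^ n := add_le_add ih le_rfl
      _ = _ := by ring

theorem expectedCost_mono (lam : ℝ≥0) (π : M.Policy) (s₁ : M.State) :
    Monotone (expectedCost lam π s₁) :=
  monotone_nat_of_le_succ fun n => by
    rw [expectedCost_succ]
    exact le_self_add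

theorem discountedValue_le_of_expectedCost_le (lam : ℝ≥0) (π : M.Policy) (s₁ : M.State)
    {C L : ℝ≥0} (h : ∀ t : ℕ, expectedCost lam π s₁ t ≤ C + t * L) {α : ℝ} (hα0 : 0 ≤ α)
    (hα1 : α < 1) : s₁.eval (M.discountedValue α lam) ≤ C + L * (1 - α)⁻¹ := by
  refine ciSup_le fun n => ?_
  have h1 := (ofReal_valueIter_le_sum hα0 lam π s₁ n).trans
    (discounted_sum_le ENNReal.coe_ne_top ENNReal.coe_ne_top
      (fun t => (sum_stageCost lam π s₁ t).le.trans (h t))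
      (ENNReal.ofReal_le_one.2 hα1.le) n)
  have h2 : ∑ i ∈ Finset.range n, ENNReal.ofReal α ^ i ≤ ENNReal.ofReal (1 - α)⁻¹ := by
    simp only [← ENNReal.ofReal_pow hα0]
    rw [← ENNReal.ofReal_sum_of_nonneg fun i _ => pow_nonneg hα0 i]
    refine ENNReal.ofReal_le_ofReal ?_
    rw [← tsum_geometric_of_lt_one hα0 hα1]
    exact (summable_geometric_of_lt_one hα0 hα1).sum_le_tsum _ fun i _ => pow_nonneg hα0 i
  have h3 := h1.trans (add_le_add le_rfl (mul_le_mul_right h2 _))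
  have h4 : (0 : ℝ) ≤ (1 - α)⁻¹ := inv_nonneg.2 (sub_nonneg.2 hα1.le)
  rw [← ENNReal.ofReal_coe_nnreal, ← ENNReal.ofReal_coe_nnreal,
    ← ENNReal.ofReal_mul L.coe_nonneg, ← ENNReal.ofReal_add C.coe_nonneg (mul_nonneg L.coe_nonneg h4)] at h3
  exact (ENNReal.ofReal_le_ofReal_iff (add_nonneg C.coe_nonneg (mul_nonneg L.coe_nonneg h4))).1 h3

/-- If the average cost were below some L < g, the t-slot costs would be at most C + tL, hence the
discounted value at most C + L/(1 - α). Multiplying by 1 - α and letting α ↑ 1 gives g ≤ L. -/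
theorem le_averageCost (lam : ℝ≥0) (π : M.Policy) (s₁ : M.State) {F : Filter ℝ} [F.NeBot]
    (hF : F ≤ 𝓝[<] 1) {g : ℝ}
    (hg : Tendsto (fun α => (1 - α) * s₁.eval (M.discountedValue α lam)) F (𝓝 g)) :
    ENNReal.ofReal g ≤ averageCost lam π s₁ := by
  by_contra! hlt
  obtain ⟨L, hL, hLg⟩ := ENNReal.lt_iff_exists_nnreal_btwn.1 hlt
  obtain ⟨N, hN⟩ := eventually_atTop.1
    ((eventually_lt_of_limsup_lt hL).and (eventually_gt_atTop 0))
  have h1 : ∀ t, N ≤ t → expectedCost lam π s₁ t ≤ t * L := by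
    intro t ht
    obtain ⟨h2, h3⟩ := hN t ht
    rw [mul_comm]
    exact (ENNReal.div_le_iff (by exact_mod_cast h3.ne') (ENNReal.natCast_ne_top t)).1 h2.le
  have h2 : ∀ t : ℕ, expectedCost lam π s₁ t ≤ (N * L : ℝ≥0) + t * L := by
    intro t
    rcases le_total N t with h | h
    · exact (h1 t h).trans le_add_self
    · refine (expectedCost_mono lam π s₁ h).trans ((h1 N le_rfl).trans ?_)
      push_cast
      exact le_self_add
  have hF1 : Tendsto (fun α : ℝ => α) F (𝓝 1) := hF.trans nhdsWithin_le_nhds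
  have hlim : Tendsto (fun α : ℝ => (1 - α) * (N * L : ℝ≥0) + L) F 
      (𝓝 ((1 - 1) * (N * L : ℝ≥0) + L)) :=
    ((hF1.const_sub 1).mul_const _).add_const _
  have hgL : g ≤ (1 - 1) * (N * L : ℝ≥0) + L := by
    refine le_of_tendsto_of_tendsto hg hlim ?_
    filter_upwards [hF (Filter.inter_mem (mem_nhdsWithin_of_mem_nhds (Ici_mem_nhds zero_lt_one))
      self_mem_nhdsWithin)] with α hα
    have hp : 0 < 1 - α := sub_pos.2 hα.2
    refine (mul_le_mul_of_nonneg_left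
      (discountedValue_le_of_expectedCost_le lam π s₁ h2 hα.1 hα.2) hp.le).trans_eq ?_
    field_simp
  rw [sub_self, zero_mul, zero_add] at hgL
  exact absurd (ENNReal.ofReal_le_ofReal hgL) (by rwa [ENNReal.ofReal_coe_nnreal, not_le])

theorem averageCost_eq_top (lam : ℝ≥0) (π : M.Policy) (s₁ : M.State) {c : ℝ}
    (h : ∀ n : ℕ, n * ((n - 1) / 2 - c) ≤ s₁.eval (M.valueIter 1 lam n)) :
    averageCost lam π s₁ = ⊤ := by
  have h1 : Tendsto (fun n : ℕ => ((n : ℝ) - 1) / 2 - c) atTop atTop :=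
    tendsto_atTop_add_const_right _ (-c)
      ((tendsto_atTop_add_const_right _ (-1) tendsto_natCast_atTop_atTop).atTop_div_const two_pos)
  have h2 := ENNReal.tendsto_ofReal_atTop.comp h1
  rw [← top_le_iff, ← h2.limsup_eq]
  refine limsup_le_limsup ?_
  filter_upwards [eventually_gt_atTop 0] with n hn
  rw [ENNReal.le_div_iff_mul_le (Or.inl (by exact_mod_cast hn.ne'))
    (Or.inl (ENNReal.natCast_ne_top n)), mul_comm, ← ENNReal.ofReal_natCast, Function.comp_apply,
    ← ENNReal.ofReal_mul (Nat.cast_nonneg n)]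
  exact (ENNReal.ofReal_le_ofReal (h n)).trans (ofReal_valueIter_one_le lam π s₁ n)

end

/-! ### Optimal threshold rules, and the degenerate channels with p01 = 0 -/

section

variable {M : AoIModel}

theorem beliefs_finite (M : AoIModel) (Δ : ℕ) : (M.beliefs Δ).Finite := by
  refine (((finite_lt_nat Δ).image fun m => M.beliefStep^[m] M.p01).union
    ((finite_lt_nat Δ).image fun m => M.beliefStep^[m] M.p11)).subset ?_
  rintro ω ⟨m, hm, h | h⟩
  · exact Or.inl ⟨m, hm, h.symm⟩
  · exact Or.inr ⟨m, hm, h.symm⟩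

/-- Only finitely many beliefs occur at each age, so the least one satisfying P serves as an
attained threshold; 2 exceeds every belief. -/
theorem isBeliefThreshold_of_upward {d : M.State → Bool} {P : ℕ → ℕ → ℝ → Prop}
    (hP : ∀ Δ k, ∀ x ∈ Icc (0 : ℝ) 1, ∀ y ∈ Icc (0 : ℝ) 1, y ≤ x → P Δ k y → P Δ k x)
    (hd : ∀ s, d s = true ↔ P s.age s.slot s.belief) : IsBeliefThreshold d := by
  have key : ∀ Δ k, ∃ r : ℝ, ∀ ω ∈ M.beliefs Δ, P Δ k ω ↔ r ≤ ω := by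
    intro Δ k
    by_cases hne : {ω | ω ∈ M.beliefs Δ ∧ P Δ k ω}.Nonempty
    · obtain ⟨r, hr, hmin⟩ := exists_min_image _ id
        ((M.beliefs_finite Δ).subset fun ω hω => hω.1) hne
      exact ⟨r, fun ω hω => ⟨fun h => hmin ω ⟨hω, h⟩, fun h =>
        hP Δ k ω (M.belief_mem_Icc hω) r (M.belief_mem_Icc hr.1) h hr.2⟩⟩
    · refine ⟨2, fun ω hω => ⟨fun h => (hne ⟨ω, hω, h⟩).elim, fun h => ?_⟩⟩
      have := (M.belief_mem_Icc hω).2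
      linarith
  choose thr hthr using key
  exact ⟨thr, fun s => (hd s).trans (hthr _ _ _ s.belief_mem)⟩

/-- In slot Δ + 1 an ACK sets the age to Δ + 1, just as a suspension does, so A(1) = -lam. By
`State.slot_eq` this covers all ages below K: resending a delivered update never pays. -/
theorem Regular.advantage_nonpos {lam : ℝ} {W : ℕ → ℕ → ℝ → ℝ} (hW : Regular lam W)
    (hlam : 0 ≤ lam) (Δ : ℕ) {ω : ℝ} (hω : ω ∈ Icc (0 : ℝ) 1) :
    M.advantage 1 lam W Δ (Δ + 1) ω ≤ 0 := by
  refine (hW.advantage_le hlam le_rfl zero_le_one Δ (Δ + 1) hω).trans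
    (mul_nonpos_of_nonneg_of_nonpos hω.1 ?_)
  simpa [advantage, suspendValue, transmitValue, beliefStep] using hlam

theorem bellman_eq_transmit {lam α : ℝ} {W : ℕ → ℕ → ℝ → ℝ} {Δ k : ℕ} {ω : ℝ}
    (h : 0 ≤ M.advantage α lam W Δ k ω) :
    M.bellman α lam W Δ k ω = Δ + (lam + α * M.transmitValue W Δ k ω) := by
  rw [bellman, min_eq_right (sub_nonneg.1 h)]

theorem bellman_eq_suspend {lam α : ℝ} {W : ℕ → ℕ → ℝ → ℝ} {Δ k : ℕ} {ω : ℝ}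
    (h : M.advantage α lam W Δ k ω ≤ 0) :
    M.bellman α lam W Δ k ω = Δ + α * M.suspendValue W Δ k ω := by
  rw [bellman, min_eq_left (sub_nonpos.1 h)]

theorem exists_optimal_of_p01_pos (hp : 0 < M.p01) (lam : ℝ≥0) :
    ∃ d : M.State → Bool, IsBeliefThreshold d ∧ (∀ s : M.State, s.age < M.K → d s = false) ∧
      ∀ (s₁ : M.State) (π : M.Policy),
        averageCost lam (stationary d) s₁ ≤ averageCost lam π s₁ := by
  classical
  obtain ⟨F, g, L, h, hF, hF1, hg, hreg, heq, hL, hlim⟩ := exists_relativeValue M hp lam.coe_nonneg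
  -- Below age K the advantage is already nonpositive, so the first condition only settles ties; it
  -- does not involve the belief and keeps the threshold form.
  let d : M.State → Bool := fun s =>
    decide (M.K ≤ s.age ∧ 0 ≤ M.advantage 1 lam h s.age s.slot s.belief)
  refine ⟨d, ?_, ?_, fun s₁ π => ?_⟩
  · exact isBeliefThreshold_of_upward
      (P := fun Δ k ω => M.K ≤ Δ ∧ 0 ≤ M.advantage 1 lam h Δ k ω)
      (fun Δ k x hx y hy hyx hP =>
        ⟨hP.1, hreg.advantage_nonneg lam.coe_nonneg le_rfl zero_le_one Δ k hx hy hyx hP.2⟩)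
      fun s => decide_eq_true_iff
  · intro s hs
    exact decide_eq_false fun hd => absurd hd.1 (not_le.2 hs)
  refine le_trans ?_ (le_averageCost lam π s₁ hF1 (hlim _ _ _ s₁.belief_mem'))
  -- The shift makes the relative values nonnegative; undiscounted, it cancels from the optimality
  -- equation.
  let h' : ℕ → ℕ → ℝ → ℝ := fun Δ k ω => h Δ k ω + L
  have h'0 : ∀ Δ k, ∀ ω ∈ Icc (0 : ℝ) 1, 0 ≤ h' Δ k ω := fun Δ k ω hω => by
    linarith [hL Δ k ω hω]
  refine averageCost_stationary_le lam (H := fun s => ENNReal.ofReal (s.eval h')) (fun s => ?_)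
    ENNReal.ofReal_ne_top
  have hb := s.belief_mem'
  have hs := heq s.age s.slot s.belief hb
  have hs0 : 0 ≤ s.eval h' := h'0 _ _ _ hb
  rw [coe_cost, ← ENNReal.ofReal_add hg hs0]
  by_cases hd : M.K ≤ s.age ∧ 0 ≤ M.advantage 1 lam h s.age s.slot s.belief
  · have hds : d s = true := decide_eq_true hd
    have ht : s.eval (M.transmitValue h') = M.transmitValue h s.age s.slot s.belief + L := by
      simp only [State.eval, transmitValue, h']
      ring
    have ht0 : 0 ≤ s.eval (M.transmitValue h') :=
      add_nonneg (mul_nonneg hb.1 (h'0 _ _ _ M.p11_mem))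
        (mul_nonneg (sub_nonneg.2 hb.2) (h'0 _ _ _ M.p01_mem))
    rw [hds, mean_transition_transmit_ofReal h'0, ← ENNReal.ofReal_add (by positivity) ht0, ht]
    refine ENNReal.ofReal_le_ofReal ?_
    rw [bellman_eq_transmit hd.2] at hs
    simp only [State.eval, h', if_true]
    linarith
  · have hds : d s = false := decide_eq_false hd
    have ht : s.eval (M.suspendValue h') = M.suspendValue h s.age s.slot s.belief + L := rfl
    have ht0 : 0 ≤ s.eval (M.suspendValue h') := h'0 _ _ _ (M.beliefStep_mem hb)
    have hadv : M.advantage 1 lam h s.age s.slot s.belief ≤ 0 := by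
      rcases lt_or_ge s.age M.K with hlt | hge
      · rw [s.slot_eq hlt]
        exact hreg.advantage_nonpos lam.coe_nonneg _ hb
      · exact (not_le.1 fun h0 => hd ⟨hge, h0⟩).le
    rw [hds, mean_transition_suspend_ofReal, ← ENNReal.ofReal_add (by simp) ht0, ht]
    refine ENNReal.ofReal_le_ofReal ?_
    rw [bellman_eq_suspend hadv] at hs
    simp only [State.eval, h', Bool.false_eq_true, if_false]
    linarith

/-- A bad channel stays bad, and a good one lasts c = 1/(1 - p11) slots on average. With weight 1 -
ω the age grows from Δ forever; with weight ω it lags behind elapsed time by at most the good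
period. So n-slot costs grow like n²/2. -/
theorem averageCost_eq_top_of_p01_eq_zero (h0 : M.p01 = 0) (h1 : M.p11 < 1) (lam : ℝ≥0)
    (π : M.Policy) (s₁ : M.State) : averageCost lam π s₁ = ⊤ := by
  have hp : 0 < 1 - M.p11 := sub_pos.2 h1
  obtain ⟨c, hc⟩ : ∃ c : ℝ, c * (1 - M.p11) = 1 := ⟨_, inv_mul_cancel₀ hp.ne'⟩
  have hc0 : 0 < c := pos_of_mul_pos_left (hc.symm ▸ one_pos : 0 < c * (1 - M.p11)) hp.le
  have key : ∀ n Δ k : ℕ, ∀ ω ∈ Icc (0 : ℝ) 1,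
      n * (n - 1) / 2 + n * (Δ * (1 - ω) - c * ω) ≤ M.valueIter 1 lam n Δ k ω := by
    intro n
    induction n with
    | zero => intro Δ k ω _; simp [valueIter]
    | succ n ih =>
      intro Δ k ω hω
      have e1 : 0 ≤ ω * (Δ + c) := mul_nonneg hω.1 (by positivity)
      have hs := ih (Δ + 1) (M.nextSlot k) _ (M.beliefStep_mem hω)
      have ha := mul_le_mul_of_nonneg_left (ih (min k (Δ + 1)) (M.nextSlot k) _ M.p11_mem) hω.1
      have hn := mul_le_mul_of_nonneg_left (ih (Δ + 1) (M.nextSlot k) _ M.p01_mem)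
        (sub_nonneg.2 hω.2)
      have hstep : M.beliefStep ω = ω * M.p11 := by rw [beliefStep, h0]; ring
      change _ ≤ M.bellman 1 lam (M.valueIter 1 lam n) Δ k ω
      rw [bellman, ← sub_le_iff_le_add', le_min_iff]
      constructor
      · rw [suspendValue, hstep, one_mul]
        rw [hstep] at hs
        have e2 : 0 ≤ n * ω * ((1 - M.p11) * (Δ + 1)) :=
          mul_nonneg (mul_nonneg n.cast_nonneg hω.1) (by positivity)
        push_cast at hs ⊢
        linear_combination hs + e1 + e2 - n * ω * hc
      · rw [transmitValue, one_mul]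
        rw [h0] at hn ⊢
        have e2 : 0 ≤ n * ω * ((min k (Δ + 1) : ℕ) * (1 - M.p11)) :=
          mul_nonneg (mul_nonneg n.cast_nonneg hω.1) (by positivity)
        have e3 := lam.coe_nonneg
        push_cast at ha hn e2 ⊢
        linear_combination ha + hn + e1 + e2 + e3 - n * ω * hc
  refine averageCost_eq_top lam π s₁ (c := c) fun n => le_trans ?_ (key n _ _ _ s₁.belief_mem')
  have hb := s₁.belief_mem'
  have e1 : (0 : ℝ) ≤ n * (s₁.age * (1 - s₁.belief)) :=
    mul_nonneg n.cast_nonneg (mul_nonneg (Nat.cast_nonneg _) (sub_nonneg.2 hb.2))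
  have e2 : (0 : ℝ) ≤ n * (c * (1 - s₁.belief)) :=
    mul_nonneg n.cast_nonneg (mul_nonneg hc0.le (sub_nonneg.2 hb.2))
  linear_combination e1 + e2

theorem averageCost_eq_top_of_belief_eq_zero (h0 : M.p01 = 0) (lam : ℝ≥0)
    (π : M.Policy) {s₁ : M.State} (hs : s₁.belief = 0) : averageCost lam π s₁ = ⊤ := by
  have hstep : M.beliefStep 0 = 0 := by simp [beliefStep, h0]
  have key : ∀ n Δ k : ℕ, (n : ℝ) * (n - 1) / 2 + n * Δ ≤ M.valueIter 1 lam n Δ k 0 := by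
    intro n
    induction n with
    | zero => intro Δ k; simp [valueIter]
    | succ n ih =>
      intro Δ k
      have h1 := ih (Δ + 1) (M.nextSlot k)
      have h2 := lam.coe_nonneg
      change _ ≤ M.bellman 1 lam (M.valueIter 1 lam n) Δ k 0
      rw [bellman, ← sub_le_iff_le_add', le_min_iff, suspendValue, transmitValue, hstep, h0]
      push_cast at h1 ⊢
      constructor <;> linarith
  refine averageCost_eq_top lam π s₁ (c := 0) fun n => ?_
  have h1 := key n s₁.age s₁.slot
  rw [State.eval, hs]
  refine le_trans ?_ h1
  have : (0 : ℝ) ≤ n * s₁.age := by positivity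
  linarith

/-- The model with the same frame length and a channel that is always good. -/
def alwaysGood (M : AoIModel) : AoIModel where
  K := M.K
  p11 := 1
  p01 := 1
  one_le_K := M.one_le_K
  p01_nonneg := zero_le_one
  p01_le_p11 := le_rfl
  p11_le_one := le_rfl

/-- At belief 1 failure has weight 0 and the belief never moves, so p01 does not enter. -/
theorem discountedValue_alwaysGood (h1 : M.p11 = 1) (α lam : ℝ) (Δ k : ℕ) :
    M.alwaysGood.discountedValue α lam Δ k 1 = M.discountedValue α lam Δ k 1 := by
  have key : ∀ n Δ k, M.alwaysGood.valueIter α lam n Δ k 1 = M.valueIter α lam n Δ k 1 := by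
    intro n
    induction n with
    | zero => intro Δ k; rfl
    | succ n ih =>
      intro Δ k
      simp only [valueIter, bellman, suspendValue, transmitValue, beliefStep, h1, sub_self,
        zero_mul, one_mul, add_zero]
      simp only [alwaysGood, nextSlot] at ih ⊢
      simp only [ih]
  simp only [discountedValue, key]

theorem belief_eq_zero_or_one (h0 : M.p01 = 0) (h1 : M.p11 = 1) (s : M.State) :
    s.belief = 0 ∨ s.belief = 1 := by
  have hid : M.beliefStep = id := by
    ext ω
    simp [beliefStep, h0, h1]
  obtain ⟨m, -, h | h⟩ := s.belief_mem
  · left; rw [h, hid, Function.iterate_id, id, h0]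
  · right; rw [h, hid, Function.iterate_id, id, h1]

theorem exists_optimal_of_static (h0 : M.p01 = 0) (h1 : M.p11 = 1) (lam : ℝ≥0) :
    ∃ d : M.State → Bool, IsBeliefThreshold d ∧ (∀ s : M.State, s.age < M.K → d s = false) ∧
      ∀ (s₁ : M.State) (π : M.Policy),
        averageCost lam (stationary d) s₁ ≤ averageCost lam π s₁ := by
  classical
  obtain ⟨F, g, L, h, hF, hF1, hg, hreg, heq, hL, hlim⟩ :=
    exists_relativeValue M.alwaysGood one_pos lam.coe_nonneg
  have one_mem : (1 : ℝ) ∈ Icc (0 : ℝ) 1 := ⟨zero_le_one, le_rfl⟩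
  let P : ℕ → ℕ → ℝ → Prop := fun Δ k ω =>
    M.K ≤ Δ ∧ 0 ≤ M.alwaysGood.advantage 1 lam h Δ k 1 ∧ ω = 1
  let d : M.State → Bool := fun s => decide (P s.age s.slot s.belief)
  refine ⟨d, ?_, ?_, fun s₁ π => ?_⟩
  · exact isBeliefThreshold_of_upward (P := P)
      (fun Δ k x hx y hy hyx hP => ⟨hP.1, hP.2.1, le_antisymm hx.2 (hP.2.2 ▸ hyx)⟩)
      fun s => decide_eq_true_iff
  · intro s hs
    exact decide_eq_false fun hd => absurd hd.1 (not_le.2 hs)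
  rcases belief_eq_zero_or_one h0 h1 s₁ with hb1 | hb1
  · rw [averageCost_eq_top_of_belief_eq_zero h0 lam π hb1]
    exact le_top
  have hlow : ENNReal.ofReal g ≤ averageCost lam π s₁ := by
    refine le_averageCost lam π s₁ hF1 ?_
    simpa only [State.eval, hb1, discountedValue_alwaysGood h1] using
      hlim s₁.age s₁.slot 1 one_mem
  refine le_trans ?_ hlow
  -- The value ⊤ off belief 1 makes the inequality trivial there, and it does no harm at belief 1,
  -- where a failure contributes 0 · ⊤ = 0.
  let H : M.State → ℝ≥0∞ := fun s =>
    if s.belief = 1 then ENNReal.ofReal (h s.age s.slot 1 + L) else ⊤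
  refine averageCost_stationary_le lam (H := H) (fun s => ?_)
    (by simp only [H, if_pos hb1]; exact ENNReal.ofReal_ne_top)
  by_cases hb : s.belief = 1
  swap
  · simp [H, hb]
  have hs := heq s.age s.slot 1 one_mem
  have hnn : ∀ Δ k, 0 ≤ h Δ k 1 + L := fun Δ k => by linarith [hL Δ k 1 one_mem]
  have hHs : H s = ENNReal.ofReal (h s.age s.slot 1 + L) := if_pos hb
  rw [coe_cost, hHs, ← ENNReal.ofReal_add hg (hnn _ _)]
  by_cases hd : P s.age s.slot s.belief
  · have hds : d s = true := decide_eq_true hd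
    have hack : H s.ack = ENNReal.ofReal (h s.slot (M.nextSlot s.slot) 1 + L) := if_pos h1
    rw [hds, mean_transition_transmit, hb, sub_self, ENNReal.ofReal_zero, zero_mul, add_zero,
      ENNReal.ofReal_one, one_mul, hack, ← ENNReal.ofReal_add (by positivity) (hnn _ _)]
    refine ENNReal.ofReal_le_ofReal ?_
    rw [bellman_eq_transmit hd.2.1, transmitValue, min_eq_left s.slot_le] at hs
    simp only [alwaysGood, nextSlot] at hs
    simp only [if_true, nextSlot]
    linarith
  · have hds : d s = false := decide_eq_false hd
    have hsus : H s.suspended = ENNReal.ofReal (h (s.age + 1) (M.nextSlot s.slot) 1 + L) :=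
      if_pos (by simp [State.suspended, beliefStep, hb, h1])
    have hadv : M.alwaysGood.advantage 1 lam h s.age s.slot 1 ≤ 0 := by
      rcases lt_or_ge s.age M.K with hlt | hge
      · rw [s.slot_eq hlt]
        exact hreg.advantage_nonpos lam.coe_nonneg _ one_mem
      · exact (not_le.1 fun h0 => hd ⟨hge, h0, hb⟩).le
    rw [hds, mean_transition_suspend, hsus, ← ENNReal.ofReal_add (by simp) (hnn _ _)]
    refine ENNReal.ofReal_le_ofReal ?_
    rw [bellman_eq_suspend hadv, suspendValue] at hs
    simp only [alwaysGood, nextSlot, beliefStep, sub_self, mul_one, add_zero] at hs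
    simp only [Bool.false_eq_true, if_false, nextSlot]
    linarith

end

end AoIModel

end

theorem theorem1 (M : AoIModel) (lam : ℝ≥0) :
    ∃ d : M.State → Bool,
      AoIModel.IsBeliefThreshold d ∧
      (∀ s : M.State, s.age < M.K → d s = false) ∧
      ∀ (s₁ : M.State) (π : M.Policy),
        AoIModel.averageCost lam (AoIModel.stationary d) s₁ ≤ AoIModel.averageCost lam π s₁ := by
  rcases M.p01_nonneg.lt_or_eq with hp | hp
  · exact AoIModel.exists_optimal_of_p01_pos hp lam
  rcases M.p11_le_one.lt_or_eq with h1 | h1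
  · refine ⟨fun _ => false, ⟨fun _ _ => 2, fun s => ?_⟩, fun _ _ => rfl, fun s₁ π => ?_⟩
    · have := s.belief_mem'.2
      simp only [Bool.false_eq_true, false_iff, not_le]
      linarith
    · rw [AoIModel.averageCost_eq_top_of_p01_eq_zero hp.symm h1 lam π s₁]
      exact le_top
  · exact AoIModel.exists_optimal_of_static hp.symm h1 lam
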